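/- Let $d\ge 1$, $a>0$, $\sigma>0$, $v>0$, $\varepsilon\ge 0$, $T\ge 0$, and put $$A=\begin{pmatrix}0&a^2\\-1&-2a\end{pmatrix}\otimes \mathbf I_d,\qquad \Sigma_\varepsilon=\begin{pmatrix}\varepsilon&0\\0&\sigma\end{pmatrix}\otimes \mathbf I_d .$$ Let $\pi_{\rm data}$ be a probability measure on $\mathbb R^d$ with Lebesgue density proportional to $e^{-V}$, where $V:\mathbb R^d\to\mathbb R$ is twice differentiable and, for some $\alpha_0,L_0>0$, $\alpha_0\mathbf I_d\preccurlyeq\nabla^2V(x)\preccurlyeq L_0\mathbf I_d$ for all $x\in\mathbb R^d$. Let $(U_t)_{t\in[0,T]}$ be a (continuous) solution of $$\mathrm dU_t=AU_t\,\mathrm dt+\Sigma_\varepsilon\,\mathrm dB_t,\qquad U_0\sim\pi_{\rm data}\otimes\mathcal N(0,v^2\mathbf I_d),$$ where $B$ is a standard $2d$-dimensional Brownian motion independent of $U_0$. Let $$\Sigma_\infty=\frac14\begin{pmatrix}5\varepsilon^2a^{-1}+a\sigma^2&-2\varepsilon^2a^{-2}\\-2\varepsilon^2a^{-2}&(\varepsilon^2+a^2\sigma^2)a^{-3}\end{pmatrix}\otimes\mathbf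 I_d,\qquad \Sigma_{0,t}=\Sigma_\infty-e^{tA}\Sigma_\infty(e^{tA})^\top,$$ $$\alpha_t=\left(\frac{1}{(\alpha_0\wedge v^{-2})\,\sigma_{\min}^2(e^{-tA})}+\lambda_{\max}(\Sigma_{0,t})\right)^{-1},$$ where $\sigma_{\min}$ is the smallest singular value and $\lambda_{\max}$ the largest eigenvalue. Then for every $t\in[0,T]$ we have $\alpha_t>0$, and the law of $U_t$ has a positive, twice differentiable Lebesgue density $p_t$ on $\mathbb R^{2d}$ (necessarily its unique continuous density) such that $$\nabla^2\log p_t(u)\preccurlyeq-\alpha_t\mathbf I_{2d}\qquad\text{for all }u\in\mathbb R^{2d}.$$ -/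

import Mathlib

open MeasureTheory ProbabilityTheory
open scoped NNReal Kronecker Matrix

namespace KineticOU

noncomputable section

/-- Position space `ℝ^d`. -/
abbrev Pos (d : ℕ) : Type := EuclideanSpace ℝ (Fin d)

/-- Phase space `ℝ^{2d}`; the index `(0, j)` is the `j`-th position coordinate and `(1, j)` is the
`j`-th velocity coordinate, which is the indexing of `M ⊗ I_d` for a `2 × 2` matrix `M`. -/
abbrev Phase (d : ℕ) : Type := EuclideanSpace ℝ (Fin 2 × Fin d)

/-- The point `(x, w)` of phase space. -/
def phasePoint {d : ℕ} (x w : Pos d) : Phase d :=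
  WithLp.toLp 2 (fun k => (![x, w] k.1) k.2)

/-! ### Hessians -/

/-- `f` is twice differentiable everywhere. -/
def TwiceDifferentiable {E : Type*} [NormedAddCommGroup E] [NormedSpace ℝ E] (f : E → ℝ) : Prop :=
  Differentiable ℝ f ∧ Differentiable ℝ (fderiv ℝ f)

/-- The quadratic form `h ↦ hᵀ ∇²f(x) h` of the Hessian. -/
def hessianForm {E : Type*} [NormedAddCommGroup E] [NormedSpace ℝ E] (f : E → ℝ) (x h : E) : ℝ :=
  fderiv ℝ (fderiv ℝ f) x h h

/-- `c I ≼ ∇²f(x)` for all `x`. -/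
def HessianGE {E : Type*} [NormedAddCommGroup E] [NormedSpace ℝ E] (c : ℝ) (f : E → ℝ) : Prop :=
  ∀ x h : E, c * ‖h‖ ^ 2 ≤ hessianForm f x h

/-- `∇²f(x) ≼ c I` for all `x`. -/
def HessianLE {E : Type*} [NormedAddCommGroup E] [NormedSpace ℝ E] (f : E → ℝ) (c : ℝ) : Prop :=
  ∀ x h : E, hessianForm f x h ≤ c * ‖h‖ ^ 2

/-! ### The data distribution -/

/-- The probability measure `π` has a Lebesgue density proportional to `exp (-V)`, where `V` is
twice differentiable and `α₀ I ≼ ∇²V(x) ≼ L₀ I` for all `x`, with `α₀, L₀ > 0`. -/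
structure StronglyLogConcaveSmooth {d : ℕ} (π : Measure (Pos d)) (V : Pos d → ℝ) (α₀ L₀ : ℝ) :
    Prop where
  isProb : IsProbabilityMeasure π
  density : ∃ c : ℝ, 0 < c ∧ π = volume.withDensity (fun x => ENNReal.ofReal (c * Real.exp (-V x)))
  twiceDiff : TwiceDifferentiable V
  alpha_pos : 0 < α₀
  L_pos : 0 < L₀
  lower : HessianGE α₀ V
  upper : HessianLE V L₀

/-- The law `π ⊗ N(0, v² I_d)` on phase space. -/
def initialLaw {d : ℕ} (π : Measure (Pos d)) (v : ℝ) : Measure (Phase d) :=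
  (π.prod (multivariateGaussian (0 : Pos d) (v ^ 2 • (1 : Matrix (Fin d) (Fin d) ℝ)))).map
    (fun q => phasePoint q.1 q.2)

/-! ### The coefficients -/

/-- The drift matrix `A`. -/
def driftMatrix (d : ℕ) (a : ℝ) : Matrix (Fin 2 × Fin d) (Fin 2 × Fin d) ℝ :=
  !![0, a ^ 2; -1, -2 * a] ⊗ₖ (1 : Matrix (Fin d) (Fin d) ℝ)

/-- The diffusion matrix `Σ_ε`. -/
def diffusionMatrix (d : ℕ) (ε σ : ℝ) : Matrix (Fin 2 × Fin d) (Fin 2 × Fin d) ℝ :=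
  !![ε, 0; 0, σ] ⊗ₖ (1 : Matrix (Fin d) (Fin d) ℝ)

/-- The stationary covariance `Σ_∞`. -/
def covInfty (d : ℕ) (a ε σ : ℝ) : Matrix (Fin 2 × Fin d) (Fin 2 × Fin d) ℝ :=
  ((1 / 4 : ℝ) • !![5 * ε ^ 2 / a + a * σ ^ 2, -2 * ε ^ 2 / a ^ 2;
      -2 * ε ^ 2 / a ^ 2, (ε ^ 2 + a ^ 2 * σ ^ 2) / a ^ 3]) ⊗ₖ (1 : Matrix (Fin d) (Fin d) ℝ)

/-- The flow `e^{tA}`. -/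
def flow (d : ℕ) (a t : ℝ) : Matrix (Fin 2 × Fin d) (Fin 2 × Fin d) ℝ :=
  NormedSpace.exp (t • driftMatrix d a)

/-- The conditional covariance `Σ_{0,t} = Σ_∞ - e^{tA} Σ_∞ (e^{tA})ᵀ`. -/
def covZero (d : ℕ) (a ε σ t : ℝ) : Matrix (Fin 2 × Fin d) (Fin 2 × Fin d) ℝ :=
  covInfty d a ε σ - flow d a t * covInfty d a ε σ * (flow d a t)ᵀ

/-! ### The forward process -/

/-- `B` is a standard Brownian motion in phase space: its coordinates are independent standard
real Brownian motions. -/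
structure IsStdBrownian {d : ℕ} {Ω : Type*} [MeasurableSpace Ω] (B : ℝ≥0 → Ω → Phase d)
    (P : Measure Ω) : Prop where
  coord : ∀ k : Fin 2 × Fin d, IsBrownianReal (fun t ω => B t ω k) P
  indep : iIndepFun (fun (k : Fin 2 × Fin d) (ω : Ω) (t : ℝ≥0) => B t ω k) P

/-- `U` is, on `[0, T]`, a solution of `dU_t = A U_t dt + Σ_ε dB_t` with `U_0 ∼ π ⊗ N(0, v² I_d)`
independent of the standard Brownian motion `B`. Since `Σ_ε` is constant, the stochastic integral
`∫₀ᵗ Σ_ε dB_s` is `Σ_ε B_t`. -/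
structure IsForwardProcess {d : ℕ} {Ω : Type*} [MeasurableSpace Ω] (P : Measure Ω)
    (a ε σ v : ℝ) (π : Measure (Pos d)) (T : ℝ≥0) (B U : ℝ≥0 → Ω → Phase d) : Prop where
  brownian : IsStdBrownian B P
  aemeasurable : ∀ t ≤ T, AEMeasurable (U t) P
  init_law : P.map (U 0) = initialLaw π v
  init_indep : IndepFun (U 0) (fun (ω : Ω) (t : ℝ≥0) => B t ω) P
  continuous : ∀ᵐ ω ∂P, ContinuousOn (fun t => U t ω) (Set.Iic T)
  equation : ∀ᵐ ω ∂P, ∀ t ≤ T,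
    U t ω = U 0 ω
      + (∫ s in (0 : ℝ)..t, Matrix.toEuclideanCLM (𝕜 := ℝ) (driftMatrix d a) (U s.toNNReal ω))
      + Matrix.toEuclideanCLM (𝕜 := ℝ) (diffusionMatrix d ε σ) (B t ω)

/-! ### The constant -/

/-- The largest eigenvalue of a symmetric real matrix. -/
def lambdaMax {n : Type*} [Fintype n] [DecidableEq n] (M : Matrix n n ℝ) : ℝ :=
  sSup (spectrum ℝ M)

/-- The smallest singular value of a square real matrix. -/
def sigmaMin {n : Type*} [Fintype n] [DecidableEq n] (M : Matrix n n ℝ) : ℝ :=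
  Real.sqrt (sInf (spectrum ℝ (Mᵀ * M)))

/-- `α_t = (1 / ((α₀ ∧ v⁻²) σ_min²(e^{-tA})) + λ_max(Σ_{0,t}))⁻¹`. -/
def alphaT (d : ℕ) (a ε σ v α₀ t : ℝ) : ℝ :=
  (1 / (min α₀ (v ^ 2)⁻¹ * sigmaMin (flow d a (-t)) ^ 2) + lambdaMax (covZero d a ε σ t))⁻¹

end

end KineticOU

namespace KineticOU

open Filter Set
open scoped Topology

/-! ### The Prékopa–Leindler inequality on the line, at the midpoint -/

/-! The equation is linear with additive noise, so `U t` has the law of `e^{tA} U_0` plus an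
independent centred Gaussian of covariance `Σ_{0,t}`. The initial potential has Hessian at least `α₀
∧ v⁻²`. Pushing forward by `e^{tA}` composes it with `e^{-tA}`, which gives strong log-concavity
with constant `α = (α₀ ∧ v⁻²) σ_min²(e^{-tA})`. Adding an independent Gaussian adds variances: `1/α`
becomes at most `1/α + λ_max(Σ_{0,t})`.

For the last claim, strong log-concavity is encoded by midpoints, `p (x + h) p (x - h) ≤ exp (-Q h)
p(x)²` with `Q` a quadratic form. In an orthonormal eigenbasis of `Σ_{0,t}` the Gaussian is added
one direction at a time. Each step is a one-dimensional integral, so Prékopa–Leindler on the line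
(`integral_mul_integral_le_sq`) suffices, and `Q` is replaced by an infimal convolution computed by
completing a square (`smoothedModulus_insert_le`). The covariance may be degenerate (it vanishes at
time zero), so regularity comes from the initial density: boundedness of `p` and of its first two
derivatives survives averaging over translates (`BoundedSmooth.smoothAlong`). At the end
`MidpointLogConcave.hessianLE_log` turns midpoints back into a Hessian bound.

The law is identified by characteristic functions (`IsForwardProcess.charFun_map_eq_covZero`). If
`η` solves `η' = -Aᵀη`, the drift drops out of `⟨η, U⟩`, whose increment is a limit of weighted sums
of Brownian increments. Their variances converge to the increment of `⟨η, Σ_∞ η⟩` by the Lyapunov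
equation. -/

theorem hasStrictDerivAt_integral_Iic {f : ℝ → ℝ} (hf : Continuous f) (hfi : Integrable f)
    (x : ℝ) : HasStrictDerivAt (fun x => ∫ y in Iic x, f y) (f x) x := by
  have h : (fun x => ∫ y in Iic x, f y) = fun x => (∫ y in Iic 0, f y) + ∫ y in (0 : ℝ)..x, f y := by
    funext x
    rw [← intervalIntegral.integral_Iic_sub_Iic hfi.integrableOn hfi.integrableOn]
    ring
  rw [h]
  exact (intervalIntegral.integral_hasStrictDerivAt_right (hf.intervalIntegrable _ _)
    hf.stronglyMeasurable.stronglyMeasurableAtFilter hf.continuousAt).const_add _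

theorem strictMono_integral_Iic {f : ℝ → ℝ} (hf : Continuous f) (hpos : ∀ x, 0 < f x)
    (hfi : Integrable f) : StrictMono (fun x => ∫ y in Iic x, f y) :=
  strictMono_of_deriv_pos fun x => by
    rw [(hasStrictDerivAt_integral_Iic hf hfi x).hasDerivAt.deriv]
    exact hpos x

theorem tendsto_integral_Iic_atTop {f : ℝ → ℝ} (hfi : Integrable f) :
    Tendsto (fun x => ∫ y in Iic x, f y) atTop (𝓝 (∫ y, f y)) :=
  (aecover_Iic tendsto_id).integral_tendsto_of_countably_generated hfi

theorem integral_Iic_mem_Ioo {f : ℝ → ℝ} (hf : Continuous f) (hpos : ∀ x, 0 < f x)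
    (hfi : Integrable f) (x : ℝ) : (∫ y in Iic x, f y) ∈ Ioo 0 (∫ y, f y) := by
  have hm := strictMono_integral_Iic hf hpos hfi
  constructor
  · have h1 : 0 ≤ ∫ y in Iic (x - 1), f y := integral_nonneg fun y => (hpos y).le
    exact h1.trans_lt (hm (by linarith : x - 1 < x))
  · exact (hm (by linarith : x < x + 1)).trans_le
      (hm.monotone.ge_of_tendsto (tendsto_integral_Iic_atTop hfi) _)

theorem exists_integral_Iic_eq {f : ℝ → ℝ} (hf : Continuous f)
    (hfi : Integrable f) {c : ℝ} (hc : c ∈ Ioo 0 (∫ y, f y)) : ∃ x, ∫ y in Iic x, f y = c := by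
  have hcont : Continuous (fun x => ∫ y in Iic x, f y) :=
    continuous_iff_continuousAt.2 fun x =>
      (hasStrictDerivAt_integral_Iic hf hfi x).hasDerivAt.continuousAt
  have h0 : Tendsto (fun x => ∫ y in Iic x, f y) atBot (𝓝 0) := tendsto_integral_Iic_zero tendsto_id
  obtain ⟨a, ha⟩ := (h0.eventually (eventually_lt_nhds hc.1)).exists
  obtain ⟨b, hb⟩ := ((tendsto_integral_Iic_atTop hfi).eventually (eventually_gt_nhds hc.2)).exists
  exact mem_range_of_exists_le_of_exists_ge hcont ⟨a, ha.le⟩ ⟨b, hb.le⟩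

/-- The increasing map that transports the normalised density `f / ∫ f` to `g / ∫ g`. -/
theorem exists_monotone_transport {f g : ℝ → ℝ} (hf : Continuous f) (hg : Continuous g)
    (hfpos : ∀ x, 0 < f x) (hgpos : ∀ x, 0 < g x) (hfi : Integrable f) (hgi : Integrable g) :
    ∃ S : ℝ → ℝ, StrictMono S ∧
      ∀ x, HasDerivAt S ((∫ y, g y) / (∫ y, f y) * f x / g (S x)) x := by
  have hF := fun x => hasStrictDerivAt_integral_Iic hf hfi x
  have hG := fun x => hasStrictDerivAt_integral_Iic hg hgi x
  have hIf : 0 < ∫ y, f y := by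
    have := integral_Iic_mem_Ioo hf hfpos hfi 0
    exact this.1.trans this.2
  have hIg : 0 < ∫ y, g y := by
    have := integral_Iic_mem_Ioo hg hgpos hgi 0
    exact this.1.trans this.2
  have hr : 0 < (∫ y, g y) / (∫ y, f y) := div_pos hIg hIf
  have hex : ∀ x, ∃ z, ∫ y in Iic z, g y = (∫ y, g y) / (∫ y, f y) * ∫ y in Iic x, f y := by
    intro x
    have hx := integral_Iic_mem_Ioo hf hfpos hfi x
    refine exists_integral_Iic_eq hg hgi ⟨mul_pos hr hx.1, ?_⟩
    calc (∫ y, g y) / (∫ y, f y) * ∫ y in Iic x, f y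
        < (∫ y, g y) / (∫ y, f y) * ∫ y, f y := mul_lt_mul_of_pos_left hx.2 hr
      _ = ∫ y, g y := by field_simp
  choose S hS using hex
  have hGm := strictMono_integral_Iic hg hgpos hgi
  have hFm := strictMono_integral_Iic hf hfpos hfi
  refine ⟨S, fun x x' hxx' => ?_, fun x => ?_⟩
  · rw [← hGm.lt_iff_lt]
    simp only [hS]
    exact mul_lt_mul_of_pos_left (hFm hxx') hr
  · have hne : g (S x) ≠ 0 := (hgpos _).ne'
    have hinv := (hG (S x)).to_localInverse hne
    have hright := (hG (S x)).eventually_right_inverse hne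
    have hFx := ((hF x).hasDerivAt.const_mul ((∫ y, g y) / (∫ y, f y)))
    rw [hS x] at hinv hright
    have hcomp := hinv.hasDerivAt.comp x hFx
    -- `S` is chosen pointwise. Injectivity of the primitive of `g` identifies it near `x` with a
    -- local inverse composed with the scaled primitive of `f`, so it is differentiable.
    have heq : S =ᶠ[𝓝 x] (hG (S x)).localInverse _ _ _ hne ∘
        fun x => (∫ y, g y) / (∫ y, f y) * ∫ y in Iic x, f y := by
      filter_upwards [hFx.continuousAt.eventually hright] with z hz
      apply hGm.injective
      simp only [hS, Function.comp]
      exact hz.symm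
    refine (hcomp.congr_of_eventuallyEq heq).congr_deriv ?_
    field_simp

/-- **Prékopa–Leindler inequality** on the real line, at the midpoint. -/
theorem integral_mul_integral_le_sq {f g h : ℝ → ℝ} (hf : Continuous f) (hg : Continuous g)
    (hfpos : ∀ x, 0 < f x) (hgpos : ∀ x, 0 < g x) (hhpos : ∀ x, 0 < h x)
    (hfi : Integrable f) (hgi : Integrable g) (hhi : Integrable h)
    (H : ∀ x y, f x * g y ≤ h ((x + y) / 2) ^ 2) :
    (∫ x, f x) * (∫ x, g x) ≤ (∫ x, h x) ^ 2 := by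
  obtain ⟨S, hSm, hS⟩ := exists_monotone_transport hf hg hfpos hgpos hfi hgi
  have hIf : 0 < ∫ y, f y := by
    have := integral_Iic_mem_Ioo hf hfpos hfi 0
    exact this.1.trans this.2
  have hIg : 0 < ∫ y, g y := by
    have := integral_Iic_mem_Ioo hg hgpos hgi 0
    exact this.1.trans this.2
  set r : ℝ := (∫ y, g y) / (∫ y, f y) with hr_def
  have hr : 0 < r := div_pos hIg hIf
  -- The substitution `z = R x` in `∫ h` evaluates `h` at the midpoint of `x` and its image under
  -- the transport, where the hypothesis `H` applies.
  set R : ℝ → ℝ := fun x => (x + S x) / 2 with hR_def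
  have hR : ∀ x, HasDerivAt R ((1 + r * f x / g (S x)) / 2) x := fun x =>
    ((hasDerivAt_id x).add (hS x)).div_const 2
  have hRinj : Function.Injective R := by
    have : StrictMono R := fun x y hxy => by
      have := hSm hxy
      simp only [hR_def]
      linarith
    exact this.injective
  have hderiv_pos : ∀ x, 0 < (1 + r * f x / g (S x)) / 2 := fun x => by
    have := hfpos x
    have := hgpos (S x)
    positivity
  -- With `u = r f(x) / g(S x)`, this is AM-GM in the form `u ≤ ((1 + u) / 2)²` combined with `H x
  -- (S x)`.
  have key : ∀ x, √r * f x ≤ |(1 + r * f x / g (S x)) / 2| • h (R x) := by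
    intro x
    rw [abs_of_pos (hderiv_pos x), smul_eq_mul]
    have hfx := hfpos x
    have hgx := hgpos (S x)
    have hhx := hhpos (R x)
    refine (sq_le_sq₀ (by positivity) (by have := hderiv_pos x; positivity)).1 ?_
    rw [mul_pow, Real.sq_sqrt hr.le, mul_pow]
    have h1 : r * f x / g (S x) ≤ ((1 + r * f x / g (S x)) / 2) ^ 2 := by
      nlinarith [sq_nonneg (1 - r * f x / g (S x))]
    calc r * f x ^ 2 = r * f x / g (S x) * (f x * g (S x)) := by field_simp
      _ ≤ ((1 + r * f x / g (S x)) / 2) ^ 2 * h (R x) ^ 2 :=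
        mul_le_mul h1 (H x (S x)) (by positivity) (by positivity)
  have himage := integral_image_eq_integral_abs_deriv_smul (s := univ) MeasurableSet.univ
    (fun x _ => (hR x).hasDerivWithinAt) hRinj.injOn h
  have hint := (integrableOn_image_iff_integrableOn_abs_deriv_smul (s := univ) MeasurableSet.univ
    (fun x _ => (hR x).hasDerivWithinAt) hRinj.injOn h).1 hhi.integrableOn
  rw [Measure.restrict_univ] at himage
  rw [integrableOn_univ] at hint
  have h1 : √r * ∫ x, f x ≤ ∫ x, h x := by
    calc √r * ∫ x, f x = ∫ x, √r * f x := (integral_const_mul _ _).symm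
      _ ≤ ∫ x, |(1 + r * f x / g (S x)) / 2| • h (R x) :=
        integral_mono (hfi.const_mul _) hint key
      _ = ∫ x in R '' univ, h x := himage.symm
      _ ≤ ∫ x, h x := setIntegral_le_integral hhi (ae_of_all _ fun x => (hhpos x).le)
  calc (∫ x, f x) * (∫ x, g x) = (√r * ∫ x, f x) ^ 2 := by
        rw [mul_pow, Real.sq_sqrt hr.le, hr_def]
        field_simp
    _ ≤ (∫ x, h x) ^ 2 := by
        gcongr

/-! ### Gaussian smoothing of a density along one direction -/

section Smoothing

variable {E : Type*} [NormedAddCommGroup E] [NormedSpace ℝ E]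

/-- `p` is positive and twice differentiable, and `p` and its first two derivatives are bounded. -/
structure BoundedSmooth (p : E → ℝ) : Prop where
  pos : ∀ x, 0 < p x
  twiceDiff : TwiceDifferentiable p
  bound : ∃ C : ℝ, ∀ x, ‖p x‖ ≤ C
  bound_fderiv : ∃ C : ℝ, ∀ x, ‖fderiv ℝ p x‖ ≤ C
  bound_fderiv_fderiv : ∃ C : ℝ, ∀ x, ‖fderiv ℝ (fderiv ℝ p) x‖ ≤ C

/-- `p (x + h) p (x - h) ≤ exp (-Q h) p(x)²`: a midpoint form of log-concavity of `p` with
modulus `Q`. -/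
def MidpointLogConcave {E : Type*} [AddCommGroup E] (Q : E → ℝ) (p : E → ℝ) : Prop :=
  ∀ x h, p (x + h) * p (x - h) ≤ Real.exp (-Q h) * p x ^ 2

theorem MidpointLogConcave.mono {E : Type*} [AddCommGroup E] {Q Q' : E → ℝ} {p : E → ℝ}
    (hp : MidpointLogConcave Q p) (h : ∀ x, Q' x ≤ Q x) : MidpointLogConcave Q' p :=
  fun x k => (hp x k).trans (by have := h k; gcongr)

/-- The density of `X + ξ e`, where `X` has density `p` and `ξ` is an independent standard
normal variable. -/
noncomputable def smoothAlong (e : E) (p : E → ℝ) (x : E) : ℝ :=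
  ∫ s, p (x - s • e) ∂gaussianReal 0 1

theorem norm_integral_translate_le {F : Type*} [NormedAddCommGroup F] [NormedSpace ℝ F]
    {f : E → F} {C : ℝ} (hC : ∀ x, ‖f x‖ ≤ C) (e x : E) (γ : Measure ℝ) [IsProbabilityMeasure γ] :
    ‖∫ s, f (x - s • e) ∂γ‖ ≤ C := by
  simpa using norm_integral_le_of_norm_le_const (μ := γ) (ae_of_all _ fun s => hC (x - s • e))

theorem BoundedSmooth.continuous {p : E → ℝ} (hp : BoundedSmooth p) : Continuous p :=
  hp.twiceDiff.1.continuous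

theorem BoundedSmooth.integrable_translate {p : E → ℝ} (hp : BoundedSmooth p) (e x : E)
    (γ : Measure ℝ) [IsFiniteMeasure γ] : Integrable (fun s : ℝ => p (x - s • e)) γ := by
  obtain ⟨C, hC⟩ := hp.bound
  have := hp.continuous
  exact Integrable.of_bound (by fun_prop) C (ae_of_all _ fun s => hC _)

/-- The parallelogram law in the exponent. Equality holds, so the standard normal density has
modulus exactly `r ^ 2`. -/
theorem gaussianPDFReal_add_mul_sub (s r : ℝ) :
    gaussianPDFReal 0 1 (s + r) * gaussianPDFReal 0 1 (s - r) =
      Real.exp (-r ^ 2) * gaussianPDFReal 0 1 s ^ 2 := by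
  simp only [gaussianPDFReal]
  rw [mul_pow, ← Real.exp_nat_mul, mul_mul_mul_comm, ← Real.exp_add, mul_left_comm, ← Real.exp_add,
    ← pow_two]
  congr 2
  simp
  ring

/-- Prékopa–Leindler is applied in the noise variable to the integrands at `x + h`, `x - h` and `x`.
Noise values `s + r` and `s - r` shift the displacement from `h` to `h - r • e` and cost a further
`r ^ 2` from the Gaussian. Hence any `Q'` below the infimal convolution `inf_r (Q (h - r • e) + r ^
2)` is a modulus for the smoothed density. -/
theorem MidpointLogConcave.smoothAlong {p : E → ℝ} (hp : BoundedSmooth p) {Q Q' : E → ℝ} {e : E}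
    (hQ : MidpointLogConcave Q p) (hQ' : ∀ (h : E) (r : ℝ), Q' h ≤ Q (h - r • e) + r ^ 2) :
    MidpointLogConcave Q' (smoothAlong e p) := by
  intro x h
  have hcont := hp.continuous
  have hγ : Continuous (gaussianPDFReal 0 1) := by
    rw [gaussianPDFReal_def]
    fun_prop
  have hγpos : ∀ s, 0 < gaussianPDFReal 0 1 s := fun s => gaussianPDFReal_pos _ _ _ one_ne_zero
  have hrepr : ∀ y, KineticOU.smoothAlong e p y =
      ∫ s, gaussianPDFReal 0 1 s * p (y - s • e) := fun y => by
    rw [KineticOU.smoothAlong, integral_gaussianReal_eq_integral_smul one_ne_zero]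
    rfl
  have hint : ∀ y, Integrable (fun s => gaussianPDFReal 0 1 s * p (y - s • e)) := fun y => by
    obtain ⟨C, hC⟩ := hp.bound
    exact (integrable_gaussianPDFReal 0 1).mul_bdd (c := C) (by fun_prop) (ae_of_all _ fun s => hC _)
  -- Half the exponent, because the right-hand side of Prékopa–Leindler is squared.
  set c : ℝ := Real.exp (-Q' h / 2) with hc
  have hcpos : 0 < c := Real.exp_pos _
  have hc2 : c ^ 2 = Real.exp (-Q' h) := by
    rw [hc, ← Real.exp_nat_mul]
    congr 1
    push_cast
    ring
  have := integral_mul_integral_le_sq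
    (f := fun s => gaussianPDFReal 0 1 s * p (x + h - s • e))
    (g := fun s => gaussianPDFReal 0 1 s * p (x - h - s • e))
    (h := fun s => c * (gaussianPDFReal 0 1 s * p (x - s • e)))
    (by fun_prop) (by fun_prop) (fun s => mul_pos (hγpos s) (hp.pos _))
    (fun s => mul_pos (hγpos s) (hp.pos _))
    (fun s => mul_pos hcpos (mul_pos (hγpos s) (hp.pos _))) (hint _) (hint _)
    ((hint _).const_mul c) ?_
  · rw [integral_const_mul, mul_pow, hc2, ← hrepr, ← hrepr, ← hrepr] at this
    exact this
  · intro s₁ s₂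
    obtain ⟨s, hs⟩ : ∃ s, s = (s₁ + s₂) / 2 := ⟨_, rfl⟩
    obtain ⟨r, hr⟩ : ∃ r, r = (s₁ - s₂) / 2 := ⟨_, rfl⟩
    have h1 : s₁ = s + r := by rw [hs, hr]; ring
    have h2 : s₂ = s - r := by rw [hs, hr]; ring
    rw [← hs, h1, h2]
    have hγ2 := gaussianPDFReal_add_mul_sub s r
    have hq := hQ (x - s • e) (h - r • e)
    have e1 : x - s • e + (h - r • e) = x + h - (s + r) • e := by module
    have e2 : x - s • e - (h - r • e) = x - h - (s - r) • e := by module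
    rw [e1, e2] at hq
    have hexp : Real.exp (-r ^ 2) * Real.exp (-Q (h - r • e)) ≤ c ^ 2 := by
      rw [hc2, ← Real.exp_add, Real.exp_le_exp]
      linarith [hQ' h r]
    calc gaussianPDFReal 0 1 (s + r) * p (x + h - (s + r) • e) *
          (gaussianPDFReal 0 1 (s - r) * p (x - h - (s - r) • e))
        = (gaussianPDFReal 0 1 (s + r) * gaussianPDFReal 0 1 (s - r)) *
          (p (x + h - (s + r) • e) * p (x - h - (s - r) • e)) := by ring
      _ ≤ (Real.exp (-r ^ 2) * gaussianPDFReal 0 1 s ^ 2) *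
          (Real.exp (-Q (h - r • e)) * p (x - s • e) ^ 2) := by
        rw [hγ2]
        gcongr
      _ = (Real.exp (-r ^ 2) * Real.exp (-Q (h - r • e))) *
          (gaussianPDFReal 0 1 s * p (x - s • e)) ^ 2 := by ring
      _ ≤ c ^ 2 * (gaussianPDFReal 0 1 s * p (x - s • e)) ^ 2 := by gcongr
      _ = (c * (gaussianPDFReal 0 1 s * p (x - s • e))) ^ 2 := by ring

end Smoothing

/-! ### Regularity of smoothed densities, and smoothing as convolution of measures -/

section Convolution

variable {E : Type*} [NormedAddCommGroup E] [InnerProductSpace ℝ E] [FiniteDimensional ℝ E]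
  [MeasurableSpace E] [BorelSpace E]

/-- The constant `C'` dominates the derivatives since `γ` is finite. The target `F` is general
because the result is applied both to `p` and to `fderiv ℝ p`; continuity of the derivative is not
needed, only its measurability. -/
theorem hasFDerivAt_integral_translate {F : Type*} [NormedAddCommGroup F] [NormedSpace ℝ F]
    [FiniteDimensional ℝ F] {f : E → F} (hf : Differentiable ℝ f) {C C' : ℝ} (hC : ∀ x, ‖f x‖ ≤ C)
    (hC' : ∀ x, ‖fderiv ℝ f x‖ ≤ C') (e x : E) (γ : Measure ℝ) [IsFiniteMeasure γ] :
    HasFDerivAt (fun x => ∫ s, f (x - s • e) ∂γ) (∫ s, fderiv ℝ f (x - s • e) ∂γ) x := by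
  have hm : ∀ y, AEStronglyMeasurable (fun s : ℝ => f (y - s • e)) γ := fun y =>
    (hf.continuous.comp (by fun_prop : Continuous fun s : ℝ => y - s • e)).aestronglyMeasurable
  refine hasFDerivAt_integral_of_dominated_of_fderiv_le (s := univ) (bound := fun _ => C')
    (F' := fun x s => fderiv ℝ f (x - s • e)) univ_mem (Eventually.of_forall hm) ?_ ?_ ?_
    (integrable_const _) ?_
  · exact Integrable.of_bound (hm x) C (ae_of_all _ fun s => hC _)
  · have : FiniteDimensional ℝ (E →L[ℝ] F) := inferInstance
    have h1 : Measurable fun s : ℝ => fderiv ℝ f (x - s • e) :=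
      (measurable_fderiv ℝ f).comp (by fun_prop : Measurable fun s : ℝ => x - s • e)
    exact h1.stronglyMeasurable.aestronglyMeasurable
  · exact ae_of_all _ fun s y _ => hC' _
  · refine ae_of_all _ fun s y _ => ?_
    have h1 : HasFDerivAt (fun y : E => y - s • e) (ContinuousLinearMap.id ℝ E) y :=
      (hasFDerivAt_id y).sub_const _
    have h2 := (hf (y - s • e)).hasFDerivAt.comp y h1
    rwa [ContinuousLinearMap.comp_id] at h2

theorem BoundedSmooth.smoothAlong {p : E → ℝ} (hp : BoundedSmooth p) (e : E) :
    BoundedSmooth (smoothAlong e p) := by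
  obtain ⟨C₀, hC₀⟩ := hp.bound
  obtain ⟨C₁, hC₁⟩ := hp.bound_fderiv
  obtain ⟨C₂, hC₂⟩ := hp.bound_fderiv_fderiv
  have h1 : ∀ x, HasFDerivAt (KineticOU.smoothAlong e p)
      (∫ s, fderiv ℝ p (x - s • e) ∂gaussianReal 0 1) x := fun x =>
    hasFDerivAt_integral_translate hp.twiceDiff.1 hC₀ hC₁ e x _
  have h1' : fderiv ℝ (KineticOU.smoothAlong e p) =
      fun x => ∫ s, fderiv ℝ p (x - s • e) ∂gaussianReal 0 1 := funext fun x => (h1 x).fderiv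
  have h2 : ∀ x, HasFDerivAt (fderiv ℝ (KineticOU.smoothAlong e p))
      (∫ s, fderiv ℝ (fderiv ℝ p) (x - s • e) ∂gaussianReal 0 1) x := fun x => by
    rw [h1']
    exact hasFDerivAt_integral_translate hp.twiceDiff.2 hC₁ hC₂ e x _
  refine ⟨fun x => ?_, ⟨fun x => (h1 x).differentiableAt, fun x => (h2 x).differentiableAt⟩,
    ⟨C₀, fun x => norm_integral_translate_le hC₀ e x _⟩, ⟨C₁, fun x => ?_⟩, ⟨C₂, fun x => ?_⟩⟩
  · have : 0 < ∫ s, p (x - s • e) ∂gaussianReal 0 1 := by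
      rw [integral_pos_iff_support_of_nonneg (fun s => (hp.pos _).le)
        (hp.integrable_translate e x _)]
      have : Function.support (fun s : ℝ => p (x - s • e)) = univ := by
        ext s
        simpa using (hp.pos (x - s • e)).ne'
      rw [this]
      simp
    exact this
  · rw [(h1 x).fderiv]
    exact norm_integral_translate_le hC₁ e x _
  · rw [(h2 x).fderiv]
    exact norm_integral_translate_le hC₂ e x _

/-- Convolution with the law of `ξ e` acts on densities as `smoothAlong e`. -/
theorem withDensity_conv_map_smul {p : E → ℝ} (hp : BoundedSmooth p) (e : E) :
    (volume.withDensity fun x => ENNReal.ofReal (p x)) ∗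
      ((gaussianReal 0 1).map fun s => s • e) =
      volume.withDensity fun x => ENNReal.ofReal (smoothAlong e p x) := by
  have hpm : Measurable fun x => ENNReal.ofReal (p x) := by
    have := hp.continuous.measurable
    fun_prop
  ext A hA
  -- Tonelli puts the noise variable outside, translation invariance of Lebesgue measure moves the
  -- shift from the indicator to `p`, and a second Tonelli returns to an integral over `A`.
  rw [← lintegral_indicator_one hA, Measure.lintegral_conv (measurable_one.indicator hA),
    lintegral_lintegral_swap, withDensity_apply _ hA, ← lintegral_indicator hA]
  · rw [lintegral_map _ (by fun_prop)]
    · have h1 : ∀ s : ℝ, (∫⁻ x, A.indicator (1 : E → ENNReal) (x + s • e)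
          ∂(volume.withDensity fun x => ENNReal.ofReal (p x))) =
          ∫⁻ x, ENNReal.ofReal (p (x - s • e)) * A.indicator 1 x := fun s => by
        have hm : Measurable fun x => A.indicator (1 : E → ENNReal) (x + s • e) :=
          (measurable_one.indicator hA).comp (measurable_add_const _)
        rw [lintegral_withDensity_eq_lintegral_mul _ hpm hm,
          ← lintegral_sub_right_eq_self _ (s • e)]
        simp
      simp_rw [h1]
      rw [lintegral_lintegral_swap]
      · refine lintegral_congr fun x => ?_
        rw [lintegral_mul_const]
        · rw [← ofReal_integral_eq_lintegral_ofReal (hp.integrable_translate e x _)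
            (ae_of_all _ fun s => (hp.pos _).le)]
          by_cases hx : x ∈ A <;> simp [hx, smoothAlong]
        · exact hpm.comp (by fun_prop)
      · refine Measurable.aemeasurable ?_
        exact (hpm.comp (by fun_prop : Measurable fun q : ℝ × E => q.2 - q.1 • e)).mul
          ((measurable_one.indicator hA).comp measurable_snd)
    · exact Measurable.lintegral_prod_left'
        ((measurable_one.indicator hA).comp (measurable_fst.add measurable_snd))
  · exact ((measurable_one.indicator hA).comp (measurable_fst.add measurable_snd)).aemeasurable

end Convolution

/-! ### Adding a Gaussian along an orthonormal family -/

section GaussianConvolution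

variable {E : Type*} [NormedAddCommGroup E] [InnerProductSpace ℝ E]

theorem charFun_map_smul_gaussianReal [MeasurableSpace E] [BorelSpace E] (e ξ : E) :
    charFun ((gaussianReal 0 1).map fun s : ℝ => s • e) ξ =
      Complex.exp (-(inner ℝ e ξ ^ 2 / 2 : ℝ)) := by
  have hm : Measurable fun s : ℝ => s • e := (by fun_prop : Continuous fun s : ℝ => s • e).measurable
  have hm' : Continuous fun x : E => Complex.exp (inner ℝ x ξ * Complex.I) := by fun_prop
  rw [charFun_apply, integral_map hm.aemeasurable]
  · have h := charFun_gaussianReal (μ := 0) (v := 1) (inner ℝ e ξ)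
    rw [charFun_apply_real] at h
    simp only [real_inner_smul_left, Complex.ofReal_mul]
    simp_rw [mul_comm (Complex.ofReal _) (inner ℝ e ξ : ℂ)]
    rw [h]
    simp
  · exact hm'.measurable.stronglyMeasurable.aestronglyMeasurable

/-- The modulus of log-concavity after smoothing in the directions `b k`, `k ∈ S`, of an
orthonormal family, with variances `l k`. -/
noncomputable def smoothedModulus {ι : Type*} (b : ι → E) (l : ι → ℝ) (α : ℝ)
    (S : Finset ι) (h : E) : ℝ :=
  α * ‖h‖ ^ 2 - ∑ k ∈ S, (α - (1 / α + l k)⁻¹) * inner ℝ (b k) h ^ 2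

/-- Orthogonality leaves the directions in `S` untouched. Along `b j`, with `x = ⟨b j, h⟩`, the
right side minus the left is the square `((1 + α l) r - α √l x)² / (1 + α l)`; the minimum over `r`
lowers the coefficient `α` to `α / (1 + α l) = (1 / α + l)⁻¹`. -/
theorem smoothedModulus_insert_le {ι : Type*} [DecidableEq ι] {b : ι → E} (hb : Orthonormal ℝ b)
    {l : ι → ℝ} (hl : ∀ k, 0 ≤ l k) {α : ℝ} (hα : 0 < α) {S : Finset ι} {j : ι} (hj : j ∉ S)
    (h : E) (r : ℝ) :
    smoothedModulus b l α (insert j S) h ≤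
      smoothedModulus b l α S (h - r • √(l j) • b j) + r ^ 2 := by
  have hsum : ∑ k ∈ S, (α - (1 / α + l k)⁻¹) * inner ℝ (b k) (h - r • √(l j) • b j) ^ 2 =
      ∑ k ∈ S, (α - (1 / α + l k)⁻¹) * inner ℝ (b k) h ^ 2 := by
    refine Finset.sum_congr rfl fun k hk => ?_
    have hkj : k ≠ j := fun hkj => hj (hkj ▸ hk)
    rw [inner_sub_right, inner_smul_right, inner_smul_right, hb.2 hkj]
    simp
  have hnorm : ‖h - r • √(l j) • b j‖ ^ 2 =
      ‖h‖ ^ 2 - 2 * r * √(l j) * inner ℝ (b j) h + r ^ 2 * l j := by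
    rw [norm_sub_sq_real, norm_smul, norm_smul, hb.1 j, inner_smul_right, inner_smul_right,
      real_inner_comm, mul_pow, Real.norm_eq_abs, sq_abs, mul_one, Real.norm_eq_abs, sq_abs,
      Real.sq_sqrt (hl j)]
    ring
  rw [smoothedModulus, smoothedModulus, Finset.sum_insert hj, hsum, hnorm]
  set x := inner ℝ (b j) h
  have hs : √(l j) ^ 2 = l j := Real.sq_sqrt (hl j)
  have hlj := hl j
  have hpos : 0 < 1 + α * l j := by positivity
  have hc : (1 / α + l j)⁻¹ = α / (1 + α * l j) := by
    field_simp
  have hsq : 0 ≤ ((1 + α * l j) * r - α * √(l j) * x) ^ 2 / (1 + α * l j) := by positivity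
  have hid : ((1 + α * l j) * r - α * √(l j) * x) ^ 2 / (1 + α * l j) =
      α * (-(2 * r * √(l j) * x) + r ^ 2 * l j) + r ^ 2 + (α - α / (1 + α * l j)) * x ^ 2 := by
    field_simp
    linear_combination (α ^ 2 * x ^ 2) * hs
  rw [hc]
  nlinarith

theorem le_smoothedModulus_univ {ι : Type*} [Fintype ι] (b : OrthonormalBasis ι ℝ E)
    {l : ι → ℝ} (hl : ∀ k, 0 ≤ l k) {α : ℝ} (hα : 0 < α) {L : ℝ} (hL : ∀ k, l k ≤ L) (h : E) :
    (1 / α + L)⁻¹ * ‖h‖ ^ 2 ≤ smoothedModulus b l α Finset.univ h := by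
  rw [smoothedModulus, ← b.sum_sq_inner_right h, Finset.mul_sum, Finset.mul_sum,
    ← Finset.sum_sub_distrib]
  refine Finset.sum_le_sum fun k _ => ?_
  have h1 : (1 / α + L)⁻¹ ≤ (1 / α + l k)⁻¹ := by
    have := hl k
    have := hL k
    gcongr
  nlinarith [sq_nonneg (inner ℝ (b k) h)]

variable [FiniteDimensional ℝ E] [MeasurableSpace E] [BorelSpace E]

/-- Induction over the directions, each step convolving with the law of `√(l j) ξ b j` for `ξ`
standard normal. Recording the characteristic function lets the final measure be recognised by
uniqueness; zero variances are allowed. -/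
theorem exists_density_of_smoothing {ι : Type*} [DecidableEq ι] {b : ι → E}
    (hb : Orthonormal ℝ b) {l : ι → ℝ} (hl : ∀ k, 0 ≤ l k) {α : ℝ} (hα : 0 < α) {p : E → ℝ}
    (hp : BoundedSmooth p) (hmid : MidpointLogConcave (fun h => α * ‖h‖ ^ 2) p)
    [IsFiniteMeasure (volume.withDensity fun x => ENNReal.ofReal (p x))] (S : Finset ι) :
    ∃ q : E → ℝ, BoundedSmooth q ∧ MidpointLogConcave (smoothedModulus b l α S) q ∧
      IsFiniteMeasure (volume.withDensity fun x => ENNReal.ofReal (q x)) ∧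
      ∀ ξ, charFun (volume.withDensity fun x => ENNReal.ofReal (q x)) ξ =
        charFun (volume.withDensity fun x => ENNReal.ofReal (p x)) ξ *
          Complex.exp (-((∑ k ∈ S, l k * inner ℝ (b k) ξ ^ 2) / 2 : ℝ)) := by
  induction S using Finset.induction_on with
  | empty => exact ⟨p, hp, hmid.mono fun h => by simp [smoothedModulus], inferInstance, by simp⟩
  | insert j S hj ih =>
    obtain ⟨q, hq, hqmid, hqfin, hqchar⟩ := ih
    have hconv := withDensity_conv_map_smul hq (√(l j) • b j)
    have hprob : IsProbabilityMeasure ((gaussianReal 0 1).map fun s : ℝ => s • √(l j) • b j) :=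
      Measure.isProbabilityMeasure_map (by fun_prop)
    refine ⟨smoothAlong (√(l j) • b j) q, hq.smoothAlong _,
      hqmid.smoothAlong hq (smoothedModulus_insert_le hb hl hα hj), ?_, fun ξ => ?_⟩
    · rw [← hconv]
      infer_instance
    · rw [← hconv, charFun_conv, hqchar, charFun_map_smul_gaussianReal, mul_assoc, ← Complex.exp_add,
        Finset.sum_insert hj, inner_smul_left]
      congr 2
      rw [mul_pow]
      simp only [conj_trivial]
      rw [Real.sq_sqrt (hl j)]
      push_cast
      ring

/-- Convolution of a strongly log-concave density with a centred Gaussian measure, expressed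
through characteristic functions. -/
theorem exists_density_of_charFun_eq {ι : Type*} [Fintype ι] [DecidableEq ι]
    (b : OrthonormalBasis ι ℝ E) {l : ι → ℝ} (hl : ∀ k, 0 ≤ l k) {L : ℝ} (hL : ∀ k, l k ≤ L)
    {α : ℝ} (hα : 0 < α) {p : E → ℝ} (hp : BoundedSmooth p)
    (hmid : MidpointLogConcave (fun h => α * ‖h‖ ^ 2) p)
    [IsFiniteMeasure (volume.withDensity fun x => ENNReal.ofReal (p x))]
    {μ : Measure E} [IsFiniteMeasure μ]
    (hμ : ∀ ξ, charFun μ ξ = charFun (volume.withDensity fun x => ENNReal.ofReal (p x)) ξ *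
          Complex.exp (-((∑ k, l k * inner ℝ (b k) ξ ^ 2) / 2 : ℝ))) :
    ∃ q : E → ℝ, BoundedSmooth q ∧ MidpointLogConcave (fun h => (1 / α + L)⁻¹ * ‖h‖ ^ 2) q ∧
      μ = volume.withDensity fun x => ENNReal.ofReal (q x) := by
  obtain ⟨q, hq, hqmid, hqfin, hqchar⟩ :=
    exists_density_of_smoothing b.orthonormal hl hα hp hmid Finset.univ
  refine ⟨q, hq, hqmid.mono (le_smoothedModulus_univ b hl hα hL), ?_⟩
  exact Measure.ext_of_charFun (funext fun ξ => by rw [hμ, hqchar])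

end GaussianConvolution

/-! ### Hessians and midpoint log-concavity -/

section Hessian

variable {E : Type*} [NormedAddCommGroup E] [NormedSpace ℝ E]

theorem TwiceDifferentiable.hasDerivAt_line {f : E → ℝ} (hf : TwiceDifferentiable f) (x h : E)
    (s : ℝ) : HasDerivAt (fun s : ℝ => f (x + s • h)) (fderiv ℝ f (x + s • h) h) s := by
  have h1 : HasDerivAt (fun s : ℝ => x + s • h) h s := by
    simpa using ((hasDerivAt_id s).smul_const h).const_add x
  exact (hf.1 (x + s • h)).hasFDerivAt.comp_hasDerivAt s h1

theorem TwiceDifferentiable.hasDerivAt_fderiv_line {f : E → ℝ} (hf : TwiceDifferentiable f)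
    (x h : E) (s : ℝ) :
    HasDerivAt (fun s : ℝ => fderiv ℝ f (x + s • h) h) (hessianForm f (x + s • h) h) s := by
  have h1 : HasDerivAt (fun s : ℝ => x + s • h) h s := by
    simpa using ((hasDerivAt_id s).smul_const h).const_add x
  have h2 := (hf.2 (x + s • h)).hasFDerivAt.comp_hasDerivAt s h1
  exact h2.clm_apply (hasDerivAt_const s h) |>.congr_deriv (by simp [hessianForm])

/-- Along every line, `f - c |·|² / 2` is convex if `c I ≼ ∇²f`. -/
theorem HessianGE.convexOn_line {f : E → ℝ} (hf : TwiceDifferentiable f) {c : ℝ}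
    (hc : HessianGE c f) (x h : E) :
    ConvexOn ℝ univ fun s : ℝ => f (x + s • h) - c * ‖h‖ ^ 2 / 2 * s ^ 2 := by
  have h1 : ∀ s, HasDerivAt (fun s : ℝ => f (x + s • h) - c * ‖h‖ ^ 2 / 2 * s ^ 2)
      (fderiv ℝ f (x + s • h) h - c * ‖h‖ ^ 2 * s) s := fun s =>
    ((hf.hasDerivAt_line x h s).sub (((hasDerivAt_id s).pow 2).const_mul _)).congr_deriv
      (by simp; ring)
  have h2 : ∀ s, HasDerivAt (fun s : ℝ => fderiv ℝ f (x + s • h) h - c * ‖h‖ ^ 2 * s)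
      (hessianForm f (x + s • h) h - c * ‖h‖ ^ 2) s := fun s =>
    ((hf.hasDerivAt_fderiv_line x h s).sub ((hasDerivAt_id s).const_mul _)).congr_deriv (by simp)
  have h1' : deriv (fun s : ℝ => f (x + s • h) - c * ‖h‖ ^ 2 / 2 * s ^ 2) =
      fun s => fderiv ℝ f (x + s • h) h - c * ‖h‖ ^ 2 * s := funext fun s => (h1 s).deriv
  refine convexOn_univ_of_deriv2_nonneg (fun s => (h1 s).differentiableAt) ?_ fun s => ?_
  · rw [h1']
    exact fun s => (h2 s).differentiableAt
  · rw [Function.iterate_succ, Function.iterate_one, Function.comp, h1', (h2 s).deriv]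
    linarith [hc (x + s • h) h]

theorem HessianGE.midpoint_le {f : E → ℝ} (hf : TwiceDifferentiable f) {c : ℝ}
    (hc : HessianGE c f) (x h : E) : 2 * f x + c * ‖h‖ ^ 2 ≤ f (x + h) + f (x - h) := by
  have := (hc.convexOn_line hf x h).2 (mem_univ 1) (mem_univ (-1))
    (by norm_num : (0 : ℝ) ≤ 1 / 2) (by norm_num : (0 : ℝ) ≤ 1 / 2) (by norm_num)
  simp only [smul_eq_mul] at this
  norm_num [← sub_eq_add_neg] at this
  linarith

/-- The tangent-line inequality for the convex restriction to a line. It supplies the Gaussian decay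
in `boundedSmooth_exp_neg`. -/
theorem HessianGE.le_apply {f : E → ℝ} (hf : TwiceDifferentiable f) {c : ℝ}
    (hc : HessianGE c f) (h : E) : f 0 + fderiv ℝ f 0 h + c / 2 * ‖h‖ ^ 2 ≤ f h := by
  have hconv := hc.convexOn_line hf 0 h
  have hd : HasDerivAt (fun s : ℝ => f (0 + s • h) - c * ‖h‖ ^ 2 / 2 * s ^ 2)
      (fderiv ℝ f 0 h) 0 :=
    ((hf.hasDerivAt_line 0 h 0).sub (((hasDerivAt_id (0 : ℝ)).pow 2).const_mul _)).congr_deriv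
      (by simp)
  have := hconv.le_slope_of_hasDerivAt (mem_univ 0) (mem_univ 1) one_pos hd
  simp [slope_def_field] at this
  linarith

theorem HessianGE.midpointLogConcave_exp {f : E → ℝ} (hf : TwiceDifferentiable f) {c : ℝ}
    (hc : HessianGE c f) :
    MidpointLogConcave (fun h => c * ‖h‖ ^ 2) fun x => Real.exp (-f x) := by
  intro x h
  rw [← Real.exp_nat_mul, ← Real.exp_add, ← Real.exp_add, Real.exp_le_exp]
  have := hc.midpoint_le hf x h
  push_cast
  linarith

/-- Polarisation: the second derivative is symmetric, and for unit vectors `‖h ± k‖² / 4 ≤ 1`. Since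
the form is nonnegative, the other term of the difference can be dropped, which gives the bound `C`
itself. -/
theorem norm_fderiv_fderiv_le {f : E → ℝ} (hf : TwiceDifferentiable f) {c C : ℝ} (hc0 : 0 ≤ c)
    (hc : HessianGE c f) (hC0 : 0 ≤ C) (hC : HessianLE f C) (x : E) :
    ‖fderiv ℝ (fderiv ℝ f) x‖ ≤ C := by
  have hsymm : ∀ h k, fderiv ℝ (fderiv ℝ f) x h k = fderiv ℝ (fderiv ℝ f) x k h :=
    second_derivative_symmetric (fun y => (hf.1 y).hasFDerivAt) (hf.2 x).hasFDerivAt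
  have hpol : ∀ h k, fderiv ℝ (fderiv ℝ f) x h k =
      (hessianForm f x (h + k) - hessianForm f x (h - k)) / 4 := fun h k => by
    simp only [hessianForm, map_add, map_sub, add_apply, _root_.sub_apply, hsymm k h]
    ring
  have hunit : ∀ h k : E, ‖h‖ = 1 → ‖k‖ = 1 → ‖fderiv ℝ (fderiv ℝ f) x h k‖ ≤ C := by
    intro h k hh hk
    have h1 := hC x (h + k)
    have h2 := hC x (h - k)
    have h3 := (by positivity : 0 ≤ c * ‖h + k‖ ^ 2).trans (hc x (h + k))
    have h4 := (by positivity : 0 ≤ c * ‖h - k‖ ^ 2).trans (hc x (h - k))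
    have h5 : ‖h + k‖ ^ 2 ≤ 2 ^ 2 := by
      have := norm_add_le h k
      gcongr
      linarith
    have h6 : ‖h - k‖ ^ 2 ≤ 2 ^ 2 := by
      have := norm_sub_le h k
      gcongr
      linarith
    have h7 := mul_le_mul_of_nonneg_left h5 hC0
    have h8 := mul_le_mul_of_nonneg_left h6 hC0
    rw [hpol, Real.norm_eq_abs, abs_le]
    constructor <;> linarith
  refine ContinuousLinearMap.opNorm_le_of_unit_norm hC0 fun h hh => ?_
  exact ContinuousLinearMap.opNorm_le_of_unit_norm hC0 fun k hk => hunit h k hh hk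

theorem exists_bound_sq_mul_exp (K L m : ℝ) (hm : 0 < m) :
    ∃ C : ℝ, ∀ r : ℝ, 0 ≤ r → (1 + K + L * r) ^ 2 * Real.exp (K * r - m * r ^ 2) ≤ C := by
  refine ⟨2 * Real.exp (|1 + K| + (|L| + K) ^ 2 / (4 * m)), fun r hr => ?_⟩
  have h1 : (1 + K + L * r) ^ 2 ≤ 2 * Real.exp (|1 + K| + |L| * r) := by
    have h2 : |1 + K + L * r| ≤ |1 + K| + |L| * r :=
      (abs_add_le _ _).trans (by rw [abs_mul, abs_of_nonneg hr])
    have h3 := Real.quadratic_le_exp_of_nonneg (abs_nonneg (1 + K + L * r))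
    have h4 := Real.exp_le_exp.2 h2
    rw [sq_abs] at h3
    linarith [abs_nonneg (1 + K + L * r)]
  calc (1 + K + L * r) ^ 2 * Real.exp (K * r - m * r ^ 2)
      ≤ 2 * Real.exp (|1 + K| + |L| * r) * Real.exp (K * r - m * r ^ 2) := by gcongr
    _ = 2 * Real.exp (|1 + K| + |L| * r + (K * r - m * r ^ 2)) := by
        rw [mul_assoc, ← Real.exp_add]
    _ ≤ 2 * Real.exp (|1 + K| + (|L| + K) ^ 2 / (4 * m)) := by
        have h5 : (|L| + K) * r - m * r ^ 2 ≤ (|L| + K) ^ 2 / (4 * m) := by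
          rw [le_div_iff₀ (by positivity)]
          nlinarith [sq_nonneg ((|L| + K) - 2 * m * r)]
        gcongr 2 * Real.exp ?_
        linarith

/-- The Hessian of `f` is bounded, so its gradient grows at most linearly, and the derivatives of
`exp (-f)` up to order two are `exp (-f)` times at most quadratic growth. The lower Hessian bound
gives Gaussian decay, which wins. -/
theorem boundedSmooth_exp_neg {f : E → ℝ} (hf : TwiceDifferentiable f) {c C : ℝ} (hc0 : 0 < c)
    (hc : HessianGE c f) (hC0 : 0 ≤ C) (hC : HessianLE f C) :
    BoundedSmooth fun x => Real.exp (-f x) := by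
  set K : ℝ := ‖fderiv ℝ f 0‖ with hK
  have hK0 : 0 ≤ K := norm_nonneg _
  have hf2 := norm_fderiv_fderiv_le hf hc0.le hc hC0 hC
  have hf1 : ∀ x, ‖fderiv ℝ f x‖ ≤ K + C * ‖x‖ := fun x => by
    have h1 := convex_univ.norm_image_sub_le_of_norm_fderiv_le (𝕜 := ℝ)
      (fun y _ => hf.2 y) (fun y _ => hf2 y) (mem_univ (0 : E)) (mem_univ x)
    have h2 := norm_le_norm_sub_add (fderiv ℝ f x) (fderiv ℝ f 0)
    rw [sub_zero] at h1
    linarith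
  have hf0 : ∀ x, Real.exp (-f x) ≤
      Real.exp (-f 0) * Real.exp (K * ‖x‖ - c / 2 * ‖x‖ ^ 2) := fun x => by
    rw [← Real.exp_add, Real.exp_le_exp]
    have h1 := hc.le_apply hf x
    have h2 := (abs_le.1 ((fderiv ℝ f 0).le_opNorm x)).1
    linarith
  obtain ⟨D, hD⟩ := exists_bound_sq_mul_exp K C (c / 2) (by positivity)
  have hbound : ∀ x, (1 + K + C * ‖x‖) ^ 2 * Real.exp (-f x) ≤ Real.exp (-f 0) * D := fun x =>
    calc (1 + K + C * ‖x‖) ^ 2 * Real.exp (-f x)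
        ≤ (1 + K + C * ‖x‖) ^ 2 *
          (Real.exp (-f 0) * Real.exp (K * ‖x‖ - c / 2 * ‖x‖ ^ 2)) := by
          gcongr
          exact hf0 x
      _ = Real.exp (-f 0) *
          ((1 + K + C * ‖x‖) ^ 2 * Real.exp (K * ‖x‖ - c / 2 * ‖x‖ ^ 2)) := by ring
      _ ≤ Real.exp (-f 0) * D := by
          gcongr
          exact hD _ (norm_nonneg x)
  have h1 : ∀ x, HasFDerivAt (fun x => Real.exp (-f x)) ((-Real.exp (-f x)) • fderiv ℝ f x) x :=
    fun x => ((hf.1 x).hasFDerivAt.neg.exp).congr_fderiv (by simp)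
  have h1' : fderiv ℝ (fun x => Real.exp (-f x)) = fun x => (-Real.exp (-f x)) • fderiv ℝ f x :=
    funext fun x => (h1 x).fderiv
  have h2 : ∀ x, HasFDerivAt (fderiv ℝ fun x => Real.exp (-f x))
      ((-Real.exp (-f x)) • fderiv ℝ (fderiv ℝ f) x +
        (-((-Real.exp (-f x)) • fderiv ℝ f x)).smulRight (fderiv ℝ f x)) x := fun x => by
    rw [h1']
    exact (h1 x).neg.smul (hf.2 x).hasFDerivAt
  have hge : ∀ x : E, 1 ≤ 1 + K + C * ‖x‖ := fun x => by
    have : 0 ≤ C * ‖x‖ := by positivity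
    linarith
  have hsq : ∀ x : E, 1 + K + C * ‖x‖ ≤ (1 + K + C * ‖x‖) ^ 2 := fun x =>
    le_self_pow₀ (hge x) two_ne_zero
  refine ⟨fun x => Real.exp_pos _,
    ⟨fun x => (h1 x).differentiableAt, fun x => (h2 x).differentiableAt⟩,
    ⟨Real.exp (-f 0) * D, fun x => ?_⟩, ⟨Real.exp (-f 0) * D, fun x => ?_⟩,
    ⟨(1 + C) * (Real.exp (-f 0) * D), fun x => ?_⟩⟩
  · rw [Real.norm_of_nonneg (Real.exp_pos _).le]
    exact (le_mul_of_one_le_left (Real.exp_pos _).le ((hge x).trans (hsq x))).trans (hbound x)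
  · rw [(h1 x).fderiv, norm_smul, norm_neg, Real.norm_of_nonneg (Real.exp_pos _).le, mul_comm]
    refine le_trans ?_ (hbound x)
    gcongr
    linarith [hf1 x, hsq x]
  · rw [(h2 x).fderiv]
    refine (norm_add_le (E := E →L[ℝ] E →L[ℝ] ℝ) _ _).trans ?_
    have hs : ‖(-Real.exp (-f x)) • fderiv ℝ (fderiv ℝ f) x‖ ≤
        Real.exp (-f x) * ‖fderiv ℝ (fderiv ℝ f) x‖ := by
      have := (fderiv ℝ (fderiv ℝ f) x).opNorm_smul_le (-Real.exp (-f x))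
      rwa [norm_neg, Real.norm_of_nonneg (Real.exp_pos _).le] at this
    refine (add_le_add_left hs _).trans ?_
    rw [ContinuousLinearMap.norm_smulRight_apply, norm_neg ((-Real.exp (-f x)) • fderiv ℝ f x),
      norm_smul, norm_neg, Real.norm_of_nonneg (Real.exp_pos _).le]
    have h3 := hf1 x
    have h4 : ‖fderiv ℝ f x‖ * ‖fderiv ℝ f x‖ ≤ (1 + K + C * ‖x‖) ^ 2 := by
      rw [pow_two]
      have : ‖fderiv ℝ f x‖ ≤ 1 + K + C * ‖x‖ := by linarith
      gcongr
    have h5 : ‖fderiv ℝ (fderiv ℝ f) x‖ ≤ C * (1 + K + C * ‖x‖) ^ 2 :=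
      (hf2 x).trans (le_mul_of_one_le_right hC0 ((hge x).trans (hsq x)))
    calc Real.exp (-f x) * ‖fderiv ℝ (fderiv ℝ f) x‖ +
          Real.exp (-f x) * ‖fderiv ℝ f x‖ * ‖fderiv ℝ f x‖
        = Real.exp (-f x) * (‖fderiv ℝ (fderiv ℝ f) x‖ + ‖fderiv ℝ f x‖ * ‖fderiv ℝ f x‖) := by
          ring
      _ ≤ Real.exp (-f x) * (C * (1 + K + C * ‖x‖) ^ 2 + (1 + K + C * ‖x‖) ^ 2) := by gcongr
      _ = (1 + C) * ((1 + K + C * ‖x‖) ^ 2 * Real.exp (-f x)) := by ring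
      _ ≤ (1 + C) * (Real.exp (-f 0) * D) :=
          mul_le_mul_of_nonneg_left (hbound x) (by positivity)

theorem TwiceDifferentiable.log {p : E → ℝ} (hp : TwiceDifferentiable p) (hpos : ∀ x, 0 < p x) :
    TwiceDifferentiable fun x => Real.log (p x) := by
  refine ⟨hp.1.log fun x => (hpos x).ne', ?_⟩
  have h : fderiv ℝ (fun x => Real.log (p x)) = fun x => (p x)⁻¹ • fderiv ℝ p x :=
    funext fun x => ((hp.1 x).hasFDerivAt.log (hpos x).ne').fderiv
  rw [h]
  exact (hp.1.inv fun x => (hpos x).ne').smul hp.2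

/-- Let `g(s) = log p(x + sh) + log p(x - sh) + β ‖h‖² s²`. The midpoint inequality says that `g` is
maximal at `0`. If the Hessian bound failed, `g''(0) > 0` would make `0` a local minimum too, so `g`
would be locally constant and `g''(0) = 0`. Continuity of the second derivative is not needed. -/
theorem MidpointLogConcave.hessianLE_log {p : E → ℝ} (hp : TwiceDifferentiable p)
    (hpos : ∀ x, 0 < p x) {β : ℝ} (hmid : MidpointLogConcave (fun h => β * ‖h‖ ^ 2) p) :
    HessianLE (fun x => Real.log (p x)) (-β) := by
  have hlog := hp.log hpos
  set F : E → ℝ := fun x => Real.log (p x) with hF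
  intro x h
  by_contra! hlt
  set g : ℝ → ℝ := fun s => F (x + s • h) + F (x + s • -h) + β * ‖h‖ ^ 2 * s ^ 2 with hg
  have h1 : ∀ s, HasDerivAt g (fderiv ℝ F (x + s • h) h + fderiv ℝ F (x + s • -h) (-h) +
      β * ‖h‖ ^ 2 * (2 * s)) s := fun s =>
    (((hlog.hasDerivAt_line x h s).add (hlog.hasDerivAt_line x (-h) s)).add
      (((hasDerivAt_id s).pow 2).const_mul _)).congr_deriv (by simp)
  have h1' : deriv g = fun s => fderiv ℝ F (x + s • h) h + fderiv ℝ F (x + s • -h) (-h) +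
      β * ‖h‖ ^ 2 * (2 * s) := funext fun s => (h1 s).deriv
  have h2 : deriv (deriv g) 0 = 2 * (hessianForm F x h + β * ‖h‖ ^ 2) := by
    rw [h1']
    have := (((hlog.hasDerivAt_fderiv_line x h 0).add
      (hlog.hasDerivAt_fderiv_line x (-h) 0)).add
      (((hasDerivAt_id (0 : ℝ)).const_mul 2).const_mul (β * ‖h‖ ^ 2)))
    refine this.deriv.trans ?_
    simp [hessianForm]
    ring
  have hle : ∀ s, g s ≤ g 0 := by
    intro s
    have h3 := hmid x (s • h)
    have h4 := Real.log_le_log (mul_pos (hpos _) (hpos _)) h3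
    rw [Real.log_mul (hpos _).ne' (hpos _).ne', Real.log_mul (Real.exp_pos _).ne'
      (pow_ne_zero _ (hpos _).ne'), Real.log_exp, Real.log_pow] at h4
    simp only [norm_smul, mul_pow, Real.norm_eq_abs, sq_abs] at h4
    simp only [hg, hF, smul_neg, ← sub_eq_add_neg, zero_smul, add_zero, sub_zero]
    push_cast at h4
    linarith
  have hmin : IsLocalMin g 0 := by
    refine isLocalMin_of_deriv_deriv_pos ?_ ?_ (h1 0).continuousAt
    · rw [h2]
      linarith
    · rw [h1']
      simp
  have hconst : g =ᶠ[𝓝 0] fun _ => g 0 := by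
    filter_upwards [hmin] with s hs using le_antisymm (hle s) hs
  have hzero : deriv (deriv g) 0 = 0 := by
    rw [hconst.deriv.deriv_eq]
    simp
  rw [h2] at hzero
  linarith

end Hessian

/-! ### Calculus of Hessians -/

section HessianCalculus

variable {E F : Type*} [NormedAddCommGroup E] [NormedSpace ℝ E] [NormedAddCommGroup F]
  [NormedSpace ℝ F]

theorem hasFDerivAt_fderiv_comp_clm {f : F → ℝ} (hf : TwiceDifferentiable f) (L : E →L[ℝ] F)
    (x : E) : HasFDerivAt (fderiv ℝ fun x => f (L x))
      (((ContinuousLinearMap.compL ℝ E F ℝ).flip L).comp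
        ((fderiv ℝ (fderiv ℝ f) (L x)).comp L)) x := by
  have h : fderiv ℝ (fun x => f (L x)) =
      fun x => (ContinuousLinearMap.compL ℝ E F ℝ).flip L (fderiv ℝ f (L x)) :=
    funext fun x => ((hf.1 (L x)).hasFDerivAt.comp x L.hasFDerivAt).fderiv
  rw [h]
  exact (ContinuousLinearMap.hasFDerivAt _).comp x
    ((hf.2 (L x)).hasFDerivAt.comp x L.hasFDerivAt)

theorem TwiceDifferentiable.comp_clm {f : F → ℝ} (hf : TwiceDifferentiable f) (L : E →L[ℝ] F) :
    TwiceDifferentiable fun x => f (L x) :=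
  ⟨hf.1.comp L.differentiable, fun x => (hasFDerivAt_fderiv_comp_clm hf L x).differentiableAt⟩

theorem hessianForm_comp_clm {f : F → ℝ} (hf : TwiceDifferentiable f) (L : E →L[ℝ] F) (x h : E) :
    hessianForm (fun x => f (L x)) x h = hessianForm f (L x) (L h) := by
  simp [hessianForm, (hasFDerivAt_fderiv_comp_clm hf L x).fderiv]

theorem hasFDerivAt_fderiv_add {f g : E → ℝ} (hf : TwiceDifferentiable f)
    (hg : TwiceDifferentiable g) (x : E) : HasFDerivAt (fderiv ℝ fun x => f x + g x)
      (fderiv ℝ (fderiv ℝ f) x + fderiv ℝ (fderiv ℝ g) x) x := by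
  have h : fderiv ℝ (fun x => f x + g x) = fun x => fderiv ℝ f x + fderiv ℝ g x :=
    funext fun x => ((hf.1 x).hasFDerivAt.add (hg.1 x).hasFDerivAt).fderiv
  rw [h]
  exact (hf.2 x).hasFDerivAt.add (hg.2 x).hasFDerivAt

theorem TwiceDifferentiable.add {f g : E → ℝ} (hf : TwiceDifferentiable f)
    (hg : TwiceDifferentiable g) : TwiceDifferentiable fun x => f x + g x :=
  ⟨hf.1.add hg.1, fun x => (hasFDerivAt_fderiv_add hf hg x).differentiableAt⟩

theorem hessianForm_add {f g : E → ℝ} (hf : TwiceDifferentiable f)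
    (hg : TwiceDifferentiable g) (x h : E) :
    hessianForm (fun x => f x + g x) x h = hessianForm f x h + hessianForm g x h := by
  simp [hessianForm, (hasFDerivAt_fderiv_add hf hg x).fderiv]

theorem TwiceDifferentiable.add_const {f : E → ℝ} (hf : TwiceDifferentiable f) (c : ℝ) :
    TwiceDifferentiable fun x => f x + c :=
  ⟨hf.1.add_const c, by
    rw [show fderiv ℝ (fun x => f x + c) = fderiv ℝ f from funext fun x => fderiv_add_const c]
    exact hf.2⟩

theorem hessianForm_add_const (f : E → ℝ) (c : ℝ) (x h : E) :
    hessianForm (fun x => f x + c) x h = hessianForm f x h := by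
  rw [hessianForm, hessianForm,
    show fderiv ℝ (fun x => f x + c) = fderiv ℝ f from funext fun x => fderiv_add_const c]

end HessianCalculus

section NormSq

variable {E : Type*} [NormedAddCommGroup E] [InnerProductSpace ℝ E]

theorem hasFDerivAt_fderiv_const_mul_norm_sq (c : ℝ) (x : E) :
    HasFDerivAt (fderiv ℝ fun x : E => c * ‖x‖ ^ 2) ((c * 2) • innerSL ℝ) x := by
  have h : fderiv ℝ (fun x : E => c * ‖x‖ ^ 2) = fun x => ((c * 2) • innerSL ℝ) x :=
    funext fun x => (((hasStrictFDerivAt_norm_sq x).hasFDerivAt.const_mul c).congr_fderiv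
      (by ext; simp; ring)).fderiv
  rw [h]
  exact ContinuousLinearMap.hasFDerivAt _

theorem twiceDifferentiable_const_mul_norm_sq (c : ℝ) :
    TwiceDifferentiable fun x : E => c * ‖x‖ ^ 2 :=
  ⟨fun x => ((hasStrictFDerivAt_norm_sq x).hasFDerivAt.const_mul c).differentiableAt,
    fun x => (hasFDerivAt_fderiv_const_mul_norm_sq c x).differentiableAt⟩

theorem hessianForm_const_mul_norm_sq (c : ℝ) (x h : E) :
    hessianForm (fun x : E => c * ‖x‖ ^ 2) x h = 2 * c * ‖h‖ ^ 2 := by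
  rw [hessianForm, (hasFDerivAt_fderiv_const_mul_norm_sq c x).fderiv]
  change c * 2 * inner ℝ h h = _
  rw [real_inner_self_eq_norm_sq]
  ring

end NormSq

/-! ### Push-forward of a density under an invertible linear map -/

section LinearMap

variable {E : Type*} [NormedAddCommGroup E] [InnerProductSpace ℝ E] [FiniteDimensional ℝ E]
  [MeasurableSpace E] [BorelSpace E]

/-- The Jacobian is written as an additive constant in the potential, where Hessians do not see it.
-/
theorem withDensity_exp_neg_map {W : E → ℝ} (hW : Measurable W) (L : E ≃L[ℝ] E) :
    (volume.withDensity fun x => ENNReal.ofReal (Real.exp (-W x))).map L =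
      volume.withDensity fun x => ENNReal.ofReal
        (Real.exp (-(W (L.symm x) + -Real.log |(LinearMap.det (L : E →ₗ[ℝ] E))⁻¹|))) := by
  have hdet : LinearMap.det (L : E →ₗ[ℝ] E) ≠ 0 := L.toLinearEquiv.isUnit_det'.ne_zero
  have hL : Measurable L := L.continuous.measurable
  have hL' : Measurable L.symm := L.symm.continuous.measurable
  have hvol : (volume : Measure E).map L =
      ENNReal.ofReal |(LinearMap.det (L : E →ₗ[ℝ] E))⁻¹| • volume :=
    Measure.map_linearMap_addHaar_eq_smul_addHaar volume hdet
  ext A hA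
  rw [Measure.map_apply hL hA, withDensity_apply _ (hL hA), withDensity_apply _ hA]
  have h1 : ∫⁻ x in L ⁻¹' A, ENNReal.ofReal (Real.exp (-W x)) =
      ∫⁻ y in A, ENNReal.ofReal (Real.exp (-W (L.symm y))) ∂(volume.map L) := by
    rw [setLIntegral_map hA (by fun_prop) hL]
    simp
  rw [h1, hvol, Measure.restrict_smul, lintegral_smul_measure, smul_eq_mul,
    ← lintegral_const_mul _ (by fun_prop)]
  refine lintegral_congr fun x => ?_
  rw [← ENNReal.ofReal_mul (abs_nonneg _), neg_add, neg_neg, Real.exp_add,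
    Real.exp_log (abs_pos.2 (inv_ne_zero hdet)), mul_comm]

end LinearMap

/-! ### The density of the initial law -/

theorem multivariateGaussian_eq_withDensity {d : ℕ} {v : ℝ} (hv : 0 < v) :
    ∃ C : ℝ, 0 < C ∧ multivariateGaussian (0 : Pos d) (v ^ 2 • (1 : Matrix (Fin d) (Fin d) ℝ)) =
      volume.withDensity fun w =>
        ENNReal.ofReal (C * Real.exp (-((2 * v ^ 2)⁻¹ * ‖w‖ ^ 2))) := by
  set b : ℝ := (2 * v ^ 2)⁻¹ with hb_def
  have hb : 0 < b := by positivity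
  set C : ℝ := ((Real.pi / b) ^ (Module.finrank ℝ (Pos d) / 2 : ℝ))⁻¹ with hC_def
  have hπb : 0 < Real.pi / b := by positivity
  have hC : 0 < C := by positivity
  refine ⟨C, hC, ?_⟩
  have hint : Integrable fun w : Pos d => C * Real.exp (-(b * ‖w‖ ^ 2)) := by
    refine Integrable.const_mul ?_ C
    -- A non-integrable function has Bochner integral zero, whereas the Gaussian integral is known
    -- to be positive.
    by_contra h
    have h1 := integral_undef h
    have h2 := GaussianFourier.integral_rexp_neg_mul_sq_norm (V := Pos d) hb
    simp only [neg_mul] at h2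
    rw [h1] at h2
    exact (Real.rpow_pos_of_pos hπb _).ne h2
  have hfin : IsFiniteMeasure (volume.withDensity fun w : Pos d =>
      ENNReal.ofReal (C * Real.exp (-(b * ‖w‖ ^ 2)))) :=
    isFiniteMeasure_withDensity_ofReal hint.2
  refine Measure.ext_of_charFun (funext fun ξ => ?_)
  have hpsd : (v ^ 2 • (1 : Matrix (Fin d) (Fin d) ℝ)).PosSemidef :=
    Matrix.PosSemidef.one.smul (sq_nonneg v)
  rw [charFun_multivariateGaussian hpsd, charFun_apply,
    integral_withDensity_eq_integral_toReal_smul (by fun_prop) (by simp)]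
  have h3 := GaussianFourier.integral_cexp_neg_mul_sq_norm_add (V := Pos d) (b := (b : ℂ))
    (by simpa using hb) Complex.I ξ
  have h4 : ∀ w : Pos d, (ENNReal.ofReal (C * Real.exp (-(b * ‖w‖ ^ 2)))).toReal •
      Complex.exp (inner ℝ w ξ * Complex.I) =
      C * Complex.exp (-b * ‖w‖ ^ 2 + Complex.I * inner ℝ ξ w) := fun w => by
    rw [ENNReal.toReal_ofReal (by positivity), Complex.exp_add, real_inner_comm w ξ,
      Complex.real_smul]
    push_cast
    rw [mul_assoc, mul_comm Complex.I, neg_mul]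
  simp_rw [h4]
  rw [integral_const_mul, h3]
  have h5 : (C : ℂ) * (Real.pi / b : ℂ) ^ (Module.finrank ℝ (Pos d) / 2 : ℂ) = 1 := by
    have : ((Real.pi / b : ℝ) : ℂ) ^ ((Module.finrank ℝ (Pos d) / 2 : ℝ) : ℂ) =
        (((Real.pi / b) ^ (Module.finrank ℝ (Pos d) / 2 : ℝ) : ℝ) : ℂ) :=
      (Complex.ofReal_cpow hπb.le _).symm
    push_cast at this
    rw [this, hC_def, ← Complex.ofReal_mul, inv_mul_cancel₀ (Real.rpow_pos_of_pos hπb _).ne']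
    simp
  rw [← mul_assoc, h5, one_mul]
  congr 1
  have h6 : (ξ : Fin d → ℝ) ⬝ᵥ (v ^ 2 • (1 : Matrix (Fin d) (Fin d) ℝ)) *ᵥ ξ = v ^ 2 * ‖ξ‖ ^ 2 := by
    rw [Matrix.smul_mulVec, Matrix.one_mulVec, dotProduct_smul, EuclideanSpace.real_norm_sq_eq]
    simp [dotProduct, pow_two]
  rw [h6, hb_def]
  have hvc : (v : ℂ) ≠ 0 := by exact_mod_cast hv.ne'
  simp only [inner_zero_right]
  push_cast
  rw [Complex.I_sq]
  field_simp
  ring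

/-- The `i`-th block of coordinates of a phase point. -/
noncomputable def block (d : ℕ) (i : Fin 2) : Phase d →L[ℝ] Pos d :=
  LinearMap.toContinuousLinearMap
    { toFun := fun u => WithLp.toLp 2 fun j => u (i, j)
      map_add' := fun _ _ => rfl
      map_smul' := fun _ _ => rfl }

theorem block_apply {d : ℕ} (i : Fin 2) (u : Phase d) (j : Fin d) : block d i u j = u (i, j) := rfl

theorem norm_sq_eq_block {d : ℕ} (u : Phase d) :
    ‖u‖ ^ 2 = ‖block d 0 u‖ ^ 2 + ‖block d 1 u‖ ^ 2 := by
  simp only [EuclideanSpace.real_norm_sq_eq, Fintype.sum_prod_type, Fin.sum_univ_two, block_apply]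

theorem block_zero_phasePoint {d : ℕ} (x w : Pos d) : block d 0 (phasePoint x w) = x := by
  ext j
  simp [block_apply, phasePoint]

theorem block_one_phasePoint {d : ℕ} (x w : Pos d) : block d 1 (phasePoint x w) = w := by
  ext j
  simp [block_apply, phasePoint]

theorem phasePoint_block {d : ℕ} (u : Phase d) : phasePoint (block d 0 u) (block d 1 u) = u := by
  ext ⟨i, j⟩
  fin_cases i <;> simp [block_apply, phasePoint]

/-- `phasePoint` as an isometry. -/
noncomputable def phaseIsometry (d : ℕ) : WithLp 2 (Pos d × Pos d) ≃ₗᵢ[ℝ] Phase d where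
  toFun z := phasePoint z.fst z.snd
  invFun u := WithLp.toLp 2 (block d 0 u, block d 1 u)
  map_add' z z' := by
    ext ⟨i, j⟩
    fin_cases i <;> simp [phasePoint]
  map_smul' c z := by
    ext ⟨i, j⟩
    fin_cases i <;> simp [phasePoint]
  left_inv z := by
    simp only [block_zero_phasePoint, block_one_phasePoint]
    rfl
  right_inv u := by simp [phasePoint_block]
  norm_map' z := by
    rw [← sq_eq_sq₀ (norm_nonneg _) (norm_nonneg _)]
    change ‖phasePoint z.fst z.snd‖ ^ 2 = _
    rw [norm_sq_eq_block, block_zero_phasePoint, block_one_phasePoint,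
      WithLp.prod_norm_sq_eq_of_L2]

theorem measurePreserving_phasePoint (d : ℕ) :
    MeasurePreserving fun q : Pos d × Pos d => phasePoint q.1 q.2 :=
  (phaseIsometry d).measurePreserving.comp (WithLp.volume_preserving_toLp (Pos d) (Pos d))

/-- The initial law has a density `exp (-W)` with `W` twice differentiable and
`(α₀ ∧ v⁻²) I ≼ ∇²W ≼ (L₀ ∨ v⁻²) I`. -/
theorem exists_initialLaw_eq_withDensity {d : ℕ} {v : ℝ} (hv : 0 < v) {π : Measure (Pos d)}
    {V : Pos d → ℝ} {α₀ L₀ : ℝ} (hπ : StronglyLogConcaveSmooth π V α₀ L₀) :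
    ∃ W : Phase d → ℝ, TwiceDifferentiable W ∧ HessianGE (min α₀ (v ^ 2)⁻¹) W ∧
      HessianLE W (max L₀ (v ^ 2)⁻¹) ∧
      initialLaw π v = volume.withDensity fun u => ENNReal.ofReal (Real.exp (-W u)) := by
  obtain ⟨c, hc, hπd⟩ := hπ.density
  obtain ⟨C, hC, hG⟩ := multivariateGaussian_eq_withDensity (d := d) hv
  have hVm : Measurable V := hπ.twiceDiff.1.continuous.measurable
  have h1 := hπ.twiceDiff.comp_clm (block d 0)
  have h2 := (twiceDifferentiable_const_mul_norm_sq (E := Pos d) (2 * v ^ 2)⁻¹).comp_clm (block d 1)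
  have hhess : ∀ u h, hessianForm (fun u => V (block d 0 u) + (2 * v ^ 2)⁻¹ * ‖block d 1 u‖ ^ 2 +
      -Real.log (c * C)) u h =
      hessianForm V (block d 0 u) (block d 0 h) + (v ^ 2)⁻¹ * ‖block d 1 h‖ ^ 2 := fun u h => by
    rw [hessianForm_add_const, hessianForm_add h1 h2, hessianForm_comp_clm hπ.twiceDiff,
      hessianForm_comp_clm (twiceDifferentiable_const_mul_norm_sq (E := Pos d) (2 * v ^ 2)⁻¹),
      hessianForm_const_mul_norm_sq]
    congr 1
    field_simp
  refine ⟨fun u => V (block d 0 u) + (2 * v ^ 2)⁻¹ * ‖block d 1 u‖ ^ 2 + -Real.log (c * C),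
    (h1.add h2).add_const _, fun u h => ?_, fun u h => ?_, ?_⟩
  · rw [hhess, norm_sq_eq_block, mul_add]
    have h3 := hπ.lower (block d 0 u) (block d 0 h)
    have h4 : min α₀ (v ^ 2)⁻¹ * ‖block d 0 h‖ ^ 2 ≤ α₀ * ‖block d 0 h‖ ^ 2 := by
      gcongr
      exact min_le_left _ _
    have h5 : min α₀ (v ^ 2)⁻¹ * ‖block d 1 h‖ ^ 2 ≤ (v ^ 2)⁻¹ * ‖block d 1 h‖ ^ 2 := by
      gcongr
      exact min_le_right _ _
    linarith
  · rw [hhess, norm_sq_eq_block, mul_add]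
    have h3 := hπ.upper (block d 0 u) (block d 0 h)
    have h4 : L₀ * ‖block d 0 h‖ ^ 2 ≤ max L₀ (v ^ 2)⁻¹ * ‖block d 0 h‖ ^ 2 := by
      gcongr
      exact le_max_left _ _
    have h5 : (v ^ 2)⁻¹ * ‖block d 1 h‖ ^ 2 ≤ max L₀ (v ^ 2)⁻¹ * ‖block d 1 h‖ ^ 2 := by
      gcongr
      exact le_max_right _ _
    linarith
  · have hmp := measurePreserving_phasePoint d
    rw [initialLaw, hG, hπd, prod_withDensity (by fun_prop) (by fun_prop)]
    ext A hA
    rw [Measure.map_apply hmp.measurable hA, withDensity_apply _ (hmp.measurable hA),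
      withDensity_apply _ hA, ← hmp.setLIntegral_comp_preimage hA (by fun_prop)]
    refine lintegral_congr fun q => ?_
    simp only [block_zero_phasePoint, block_one_phasePoint]
    rw [neg_add, neg_add, neg_neg, Real.exp_add,
      Real.exp_add, Real.exp_log (by positivity), ← ENNReal.ofReal_mul (by positivity)]
    congr 1
    ring

/-! ### Riemann sums -/

/-- An interval functional that is a small perturbation of the increments of `G` sums up to the
total increment of `G`. -/
theorem tendsto_sum_of_increment_approx {t : ℝ} (ht : 0 ≤ t) {F : ℝ → ℝ → ℝ} {G : ℝ → ℝ}
    (h : ∀ δ > 0, ∃ ρ > 0, ∀ a b, 0 ≤ a → a ≤ b → b ≤ t → b - a < ρ →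
      |F a b - (G b - G a)| ≤ δ * (b - a)) :
    Tendsto (fun n : ℕ => ∑ i ∈ Finset.range (n + 1),
      F (i * t / (n + 1)) (((i + 1 : ℕ) : ℝ) * t / (n + 1))) atTop (𝓝 (G t - G 0)) := by
  rw [Metric.tendsto_atTop]
  intro e he
  -- The errors add up to `e * t / (t + 1)`, strictly below `e` even for `t = 0`.
  obtain ⟨ρ, hρ, hF⟩ := h (e / (t + 1)) (by positivity)
  obtain ⟨N, hN⟩ := exists_nat_gt (t / ρ)
  refine ⟨N, fun n hn => ?_⟩
  have hn1 : (0 : ℝ) < n + 1 := by positivity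
  have htel : G t - G 0 = ∑ i ∈ Finset.range (n + 1),
      (G (((i + 1 : ℕ) : ℝ) * t / (n + 1)) - G (i * t / (n + 1))) := by
    rw [Finset.sum_range_sub (fun i : ℕ => G (i * t / (n + 1)))]
    push_cast
    rw [mul_div_cancel_left₀ _ hn1.ne']
    simp
  have hstep : ∀ i : ℕ, ((i + 1 : ℕ) : ℝ) * t / (n + 1) - i * t / (n + 1) = t / (n + 1) := by
    intro i
    push_cast
    ring
  have hmesh : t / (n + 1) < ρ := by
    rw [div_lt_iff₀ hn1]
    rw [div_lt_iff₀ hρ] at hN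
    have : (N : ℝ) ≤ n := by exact_mod_cast hn
    nlinarith
  rw [Real.dist_eq, htel, ← Finset.sum_sub_distrib]
  calc |∑ i ∈ Finset.range (n + 1), (F (i * t / (n + 1)) (((i + 1 : ℕ) : ℝ) * t / (n + 1)) -
        (G (((i + 1 : ℕ) : ℝ) * t / (n + 1)) - G (i * t / (n + 1))))|
      ≤ ∑ i ∈ Finset.range (n + 1), |F (i * t / (n + 1)) (((i + 1 : ℕ) : ℝ) * t / (n + 1)) -
        (G (((i + 1 : ℕ) : ℝ) * t / (n + 1)) - G (i * t / (n + 1)))| :=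
        Finset.abs_sum_le_sum_abs _ _
    _ ≤ ∑ i ∈ Finset.range (n + 1), e / (t + 1) * (t / (n + 1)) := by
        refine Finset.sum_le_sum fun i hi => ?_
        rw [← hstep i]
        refine hF _ _ (by positivity) ?_ ?_ ?_
        · have := hstep i
          have : 0 ≤ t / (n + 1) := by positivity
          linarith
        · rw [div_le_iff₀ hn1, mul_comm]
          have : ((i + 1 : ℕ) : ℝ) ≤ n + 1 := by exact_mod_cast Finset.mem_range.1 hi
          gcongr
        · rw [hstep]
          exact hmesh
    _ = e * (t / (t + 1)) := by
        rw [Finset.sum_const, Finset.card_range, nsmul_eq_mul]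
        push_cast
        field_simp
    _ < e := by
        have : t / (t + 1) < 1 := by
          rw [div_lt_one (by positivity)]
          linarith
        nlinarith

theorem tendsto_riemann_sum {t : ℝ} (ht : 0 ≤ t) {g G : ℝ → ℝ} (hg : Continuous g)
    (hG : ∀ s, HasDerivAt G (g s) s) :
    Tendsto (fun n : ℕ => ∑ i ∈ Finset.range (n + 1),
      g (i * t / (n + 1)) * (((i + 1 : ℕ) : ℝ) * t / (n + 1) - i * t / (n + 1))) atTop
      (𝓝 (G t - G 0)) := by
  refine tendsto_sum_of_increment_approx (F := fun a b => g a * (b - a)) ht fun δ hδ => ?_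
  obtain ⟨ρ, hρ, hunif⟩ := Metric.uniformContinuousOn_iff.1
    (isCompact_Icc.uniformContinuousOn_of_continuous (hg.continuousOn (s := Icc 0 t))) δ hδ
  refine ⟨ρ, hρ, fun a b ha hab hb hlt => ?_⟩
  have hint : G b - G a = ∫ s in a..b, g s :=
    (intervalIntegral.integral_eq_sub_of_hasDerivAt (fun s _ => hG s)
      (hg.intervalIntegrable _ _)).symm
  have h1 : g a * (b - a) - (G b - G a) = ∫ s in a..b, (g a - g s) := by
    rw [intervalIntegral.integral_sub (by simp) (hg.intervalIntegrable _ _),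
      intervalIntegral.integral_const, hint, smul_eq_mul, mul_comm]
  rw [h1, ← Real.norm_eq_abs, ← abs_of_nonneg (sub_nonneg.2 hab)]
  refine intervalIntegral.norm_integral_le_of_norm_le_const fun s hs => ?_
  rw [uIoc_of_le hab] at hs
  refine (hunif a ⟨ha, hab.trans hb⟩ s ⟨ha.trans hs.1.le, hs.2.trans hb⟩ ?_).le
  rw [Real.dist_eq, abs_sub_comm, abs_of_pos (sub_pos.2 hs.1)]
  linarith [hs.2]

/-! ### Pathwise integration by parts against the adjoint equation -/

section Path

variable {E : Type*} [NormedAddCommGroup E] [InnerProductSpace ℝ E] [CompleteSpace E]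

/-- The discretised integrals of a solution `η` of the adjoint equation against the driving path
of a linear equation converge. -/
theorem tendsto_sum_inner_increments {t : ℝ} (ht : 0 ≤ t) (A : E →L[ℝ] E) {η U X : ℝ → E}
    (hη : ∀ s, HasDerivAt η (-(A.adjoint (η s))) s) (hU : ContinuousOn U (Icc 0 t))
    (hX : ∀ s ∈ Icc 0 t, U s = U 0 + (∫ r in (0 : ℝ)..s, A (U r)) + X s) :
    Tendsto (fun n : ℕ => ∑ i ∈ Finset.range (n + 1), inner ℝ (η (i * t / (n + 1)))
      (X (((i + 1 : ℕ) : ℝ) * t / (n + 1)) - X (i * t / (n + 1)))) atTop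
      (𝓝 (inner ℝ (η t) (U t) - inner ℝ (η 0) (U 0))) := by
  have hηc : Continuous η := continuous_iff_continuousAt.2 fun s => (hη s).continuousAt
  have hζc : Continuous fun s => A.adjoint (η s) := by fun_prop
  set ζ : ℝ → E := fun s => A.adjoint (η s) with hζ
  obtain ⟨M, hM⟩ := isCompact_Icc.exists_bound_of_continuousOn (hζc.continuousOn (s := Icc 0 t))
  obtain ⟨K, hK⟩ := isCompact_Icc.exists_bound_of_continuousOn hU
  have hM0 : 0 ≤ M := (norm_nonneg _).trans (hM 0 ⟨le_rfl, ht⟩)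
  have hK0 : 0 ≤ K := (norm_nonneg _).trans (hK 0 ⟨le_rfl, ht⟩)
  refine tendsto_sum_of_increment_approx (F := fun a b => inner ℝ (η a) (X b - X a))
    (G := fun s => inner ℝ (η s) (U s)) ht fun δ hδ => ?_
  have hδ' : 0 < δ / (M + K + 1) := by positivity
  obtain ⟨ρ₁, hρ₁, hunif₁⟩ := Metric.uniformContinuousOn_iff.1
    (isCompact_Icc.uniformContinuousOn_of_continuous (hζc.continuousOn (s := Icc 0 t))) _ hδ'
  obtain ⟨ρ₂, hρ₂, hunif₂⟩ := Metric.uniformContinuousOn_iff.1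
    (isCompact_Icc.uniformContinuousOn_of_continuous hU) _ hδ'
  refine ⟨min ρ₁ ρ₂, lt_min hρ₁ hρ₂, fun a b ha hab hb hlt => ?_⟩
  have hsub : uIcc a b ⊆ Icc 0 t := by
    rw [uIcc_of_le hab]
    exact Icc_subset_Icc ha hb
  have hUint : ∀ c d, c ∈ Icc 0 t → d ∈ Icc 0 t → IntervalIntegrable (fun r => A (U r)) volume c d :=
    fun c d hc hd => ContinuousOn.intervalIntegrable
      (A.continuous.comp_continuousOn (hU.mono (ordConnected_Icc.uIcc_subset hc hd)))
  have ham : a ∈ Icc 0 t := ⟨ha, hab.trans hb⟩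
  have hbm : b ∈ Icc 0 t := ⟨ha.trans hab, hb⟩
  have h0m : (0 : ℝ) ∈ Icc 0 t := ⟨le_rfl, ht⟩
  have hXab : X b - X a = U b - U a - ∫ r in a..b, A (U r) := by
    rw [← intervalIntegral.integral_interval_sub_left (hUint 0 b h0m hbm) (hUint 0 a h0m ham)]
    have e1 := hX a ham
    have e2 := hX b hbm
    rw [eq_comm, ← eq_sub_iff_add_eq'] at e1 e2
    rw [e1, e2]
    abel
  have hηab : η b - η a = -∫ s in a..b, ζ s := by
    rw [← intervalIntegral.integral_neg]
    exact (intervalIntegral.integral_eq_sub_of_hasDerivAt (fun s _ => hη s)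
      (hζc.neg.intervalIntegrable _ _)).symm
  have hζU : IntervalIntegrable (fun s => inner ℝ (ζ s) (U b)) volume a b :=
    (by fun_prop : Continuous fun s => inner ℝ (ζ s) (U b)).intervalIntegrable _ _
  have hζU' : IntervalIntegrable (fun s => inner ℝ (ζ a) (U s)) volume a b :=
    (continuousOn_const.inner (hU.mono hsub)).intervalIntegrable
  -- Integration by parts: `η' = -A*η` cancels the drift to first order. What remains compares `ζ`
  -- and `U` at nearby times and is small by uniform continuity, with no regularity of `X` used.
  have hkey : inner ℝ (η a) (X b - X a) - (inner ℝ (η b) (U b) - inner ℝ (η a) (U a)) =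
      ∫ s in a..b, (inner ℝ (ζ s) (U b) - inner ℝ (ζ a) (U s)) := by
    have e1 : ∫ s in a..b, inner ℝ (ζ s) (U b) = inner ℝ (∫ s in a..b, ζ s) (U b) := by
      have := (innerSL ℝ (U b)).intervalIntegral_comp_comm (hζc.intervalIntegrable (μ := volume) a b)
      simpa [real_inner_comm] using this
    have e2 : ∫ s in a..b, inner ℝ (ζ a) (U s) = inner ℝ (η a) (∫ s in a..b, A (U s)) := by
      have := (innerSL ℝ (η a)).intervalIntegral_comp_comm (hUint a b ham hbm)
      simp only [innerSL_apply_apply] at this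
      rw [← this]
      simp only [hζ, ContinuousLinearMap.adjoint_inner_left]
    rw [intervalIntegral.integral_sub hζU hζU', e1, e2, hXab]
    have e3 : ∫ s in a..b, ζ s = η a - η b := by rw [← neg_sub, hηab, neg_neg]
    rw [e3]
    simp only [inner_sub_left, inner_sub_right]
    ring
  rw [hkey, ← Real.norm_eq_abs]
  rw [← abs_of_nonneg (sub_nonneg.2 hab)]
  refine intervalIntegral.norm_integral_le_of_norm_le_const fun s hs => ?_
  rw [uIoc_of_le hab] at hs
  have hsm : s ∈ Icc 0 t := ⟨ha.trans hs.1.le, hs.2.trans hb⟩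
  have d1 : ‖ζ s - ζ a‖ ≤ δ / (M + K + 1) := by
    rw [← dist_eq_norm]
    refine (hunif₁ s hsm a ham ?_).le
    rw [Real.dist_eq, abs_of_pos (sub_pos.2 hs.1)]
    linarith [hs.2, min_le_left ρ₁ ρ₂]
  have d2 : ‖U b - U s‖ ≤ δ / (M + K + 1) := by
    rw [← dist_eq_norm]
    refine (hunif₂ b hbm s hsm ?_).le
    rw [Real.dist_eq, abs_of_nonneg (sub_nonneg.2 hs.2)]
    linarith [hs.1, min_le_right ρ₁ ρ₂]
  have hsplit : inner ℝ (ζ s) (U b) - inner ℝ (ζ a) (U s) =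
      inner ℝ (ζ s) (U b - U s) + inner ℝ (ζ s - ζ a) (U s) := by
    simp only [inner_sub_left, inner_sub_right]
    ring
  rw [hsplit]
  calc ‖inner ℝ (ζ s) (U b - U s) + inner ℝ (ζ s - ζ a) (U s)‖
      ≤ ‖ζ s‖ * ‖U b - U s‖ + ‖ζ s - ζ a‖ * ‖U s‖ :=
        (norm_add_le _ _).trans (add_le_add (norm_inner_le_norm _ _) (norm_inner_le_norm _ _))
    _ ≤ M * (δ / (M + K + 1)) + δ / (M + K + 1) * K := by
        gcongr
        · exact hM s hsm
        · exact hK s hsm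
    _ = δ * ((M + K) / (M + K + 1)) := by ring
    _ ≤ δ := by
        have : (M + K) / (M + K + 1) ≤ 1 := by
          rw [div_le_one (by positivity)]
          linarith
        nlinarith

end Path

/-! ### Weighted sums of Brownian increments -/

section Brownian

variable {Ω : Type*} [MeasurableSpace Ω] {P : Measure Ω}

/-- Independent increments factor the characteristic function. Frequency `1` suffices because the
weights `c` absorb any scaling. -/
theorem charFun_map_sum_increments [IsProbabilityMeasure P] {B : ℝ≥0 → Ω → ℝ}
    (hB : IsPreBrownianReal B P)
    {τ : ℕ → ℝ≥0} (hτ : Monotone τ) (c : ℕ → ℝ) (n : ℕ) :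
    charFun (P.map fun ω => ∑ i ∈ Finset.range n, c i * (B (τ (i + 1)) ω - B (τ i) ω)) 1 =
      Complex.exp (-((∑ i ∈ Finset.range n, c i ^ 2 * (τ (i + 1) - τ i : ℝ)) / 2 : ℝ)) := by
  have hm : ∀ i, AEMeasurable (B i) P := hB.aemeasurable
  have hind : iIndepFun (fun i ω => c i * (B (τ (i + 1)) ω - B (τ i) ω)) P :=
    (hB.hasIndepIncrements.nat hτ).comp (fun i x => c i * x) fun i => by fun_prop
  rw [iIndepFun.charFun_map_fun_finsetSum_eq_prod
    (X := fun i ω => c i * (B (τ (i + 1)) ω - B (τ i) ω)) (fun i _ => by fun_prop)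
    (hind.restrict _), Finset.prod_apply]
  have h1 : ∀ i, charFun (P.map fun ω => c i * (B (τ (i + 1)) ω - B (τ i) ω)) 1 =
      Complex.exp (-(c i ^ 2 * (τ (i + 1) - τ i : ℝ) / 2 : ℝ)) := fun i => by
    have hlaw := (hB.hasLaw_sub (τ (i + 1)) (τ i)).map_eq
    have h2 := charFun_map_mul_comp (μ := P) (f := B (τ (i + 1)) - B (τ i))
      (((hm _).sub (hm _))) (c i) 1
    simp only [Pi.sub_apply] at h2
    rw [h2, hlaw, charFun_gaussianReal]
    -- The increment's variance is given as a distance of times; monotonicity of `τ` removes the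
    -- absolute value.
    have h3 : ((nndist (τ (i + 1)).1 (τ i).1 : ℝ≥0) : ℝ) = τ (i + 1) - τ i := by
      rw [coe_nndist, Real.dist_eq, abs_of_nonneg]
      · rfl
      · exact sub_nonneg.2 (NNReal.coe_le_coe.2 (hτ (Nat.le_succ i)))
    congr 1
    rw [show ((nndist (τ (i + 1)).1 (τ i).1 : ℝ≥0) : ℂ) =
      (((nndist (τ (i + 1)).1 (τ i).1 : ℝ≥0) : ℝ) : ℂ) from rfl, h3]
    push_cast
    ring
  simp_rw [h1]
  rw [← Complex.exp_sum]
  congr 1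
  push_cast
  rw [Finset.sum_neg_distrib, Finset.sum_div]

variable {d : ℕ}

theorem IsStdBrownian.aemeasurable {B : ℝ≥0 → Ω → Phase d} (hB : IsStdBrownian B P) (t : ℝ≥0) :
    AEMeasurable (B t) P := by
  have h : AEMeasurable (fun ω k => B t ω k) P :=
    aemeasurable_pi_lambda _ fun k => (hB.coord k).toIsPreBrownianReal.aemeasurable t
  exact (PiLp.continuous_toLp 2 _).measurable.comp_aemeasurable h

theorem IsStdBrownian.charFun_map_sum_increments [IsProbabilityMeasure P] {B : ℝ≥0 → Ω → Phase d}
    (hB : IsStdBrownian B P)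
    {τ : ℕ → ℝ≥0} (hτ : Monotone τ) (w : ℕ → Phase d) (n : ℕ) :
    charFun (P.map fun ω => ∑ i ∈ Finset.range n, inner ℝ (w i) (B (τ (i + 1)) ω - B (τ i) ω)) 1 =
      Complex.exp (-((∑ i ∈ Finset.range n, ‖w i‖ ^ 2 * (τ (i + 1) - τ i : ℝ)) / 2 : ℝ)) := by
  have hsum : (fun ω => ∑ i ∈ Finset.range n, inner ℝ (w i) (B (τ (i + 1)) ω - B (τ i) ω)) =
      fun ω => ∑ k, ∑ i ∈ Finset.range n, w i k * (B (τ (i + 1)) ω k - B (τ i) ω k) := by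
    funext ω
    rw [Finset.sum_comm]
    refine Finset.sum_congr rfl fun i _ => ?_
    simp [PiLp.inner_apply, mul_comm]
  have hm : ∀ k t, AEMeasurable (fun ω => B t ω k) P := fun k =>
    (hB.coord k).toIsPreBrownianReal.aemeasurable
  have hind : iIndepFun (fun k ω =>
      ∑ i ∈ Finset.range n, w i k * (B (τ (i + 1)) ω k - B (τ i) ω k)) P :=
    hB.indep.comp (fun k (x : ℝ≥0 → ℝ) =>
      ∑ i ∈ Finset.range n, w i k * (x (τ (i + 1)) - x (τ i))) fun k => by fun_prop
  rw [hsum, hind.charFun_map_fun_sum_eq_prod (fun k => by fun_prop), Finset.prod_apply]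
  have h1 : ∀ k, charFun (P.map fun ω =>
      ∑ i ∈ Finset.range n, w i k * (B (τ (i + 1)) ω k - B (τ i) ω k)) 1 =
      Complex.exp (-((∑ i ∈ Finset.range n, w i k ^ 2 * (τ (i + 1) - τ i : ℝ)) / 2 : ℝ)) :=
    fun k => KineticOU.charFun_map_sum_increments (hB.coord k).toIsPreBrownianReal hτ
      (fun i => w i k) n
  simp_rw [h1]
  rw [← Complex.exp_sum, ← Complex.ofReal_neg]
  simp_rw [← Complex.ofReal_neg]
  rw [← Complex.ofReal_sum]
  congr 2
  rw [Finset.sum_neg_distrib, ← Finset.sum_div, Finset.sum_comm]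
  simp_rw [EuclideanSpace.real_norm_sq_eq, Finset.sum_mul]

end Brownian

/-! ### The characteristic function of the forward process -/

section Forward

variable {Ω : Type*} [MeasurableSpace Ω] {P : Measure Ω} {d : ℕ}
  {a ε σ v : ℝ} {π : Measure (Pos d)} {T : ℝ≥0} {B U : ℝ≥0 → Ω → Phase d}

/-- For a solution `η` of the adjoint equation, `⟨η t, U t⟩` is a.s. the limit of
`⟨η 0, U 0⟩` plus discretised Wiener integrals. -/
theorem IsForwardProcess.ae_tendsto (hU : IsForwardProcess P a ε σ v π T B U) {t : ℝ≥0}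
    (ht : t ≤ T) {η : ℝ → Phase d}
    (hη : ∀ s, HasDerivAt η
      (-((Matrix.toEuclideanCLM (𝕜 := ℝ) (driftMatrix d a)).adjoint (η s))) s) :
    ∀ᵐ ω ∂P, Tendsto (fun n : ℕ => inner ℝ (η 0) (U 0 ω) + ∑ i ∈ Finset.range (n + 1),
      inner ℝ ((Matrix.toEuclideanCLM (𝕜 := ℝ) (diffusionMatrix d ε σ)).adjoint
          (η ((i : ℝ) * t / (n + 1))))
        (B (((i + 1 : ℕ) : ℝ≥0) * t / (n + 1)) ω - B ((i : ℝ≥0) * t / (n + 1)) ω)) atTop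
      (𝓝 (inner ℝ (η t) (U t ω))) := by
  filter_upwards [hU.continuous, hU.equation] with ω hcont heq
  have hcont' : ContinuousOn (fun s : ℝ => U s.toNNReal ω) (Icc 0 (t : ℝ)) := by
    refine hcont.comp continuous_real_toNNReal.continuousOn fun s hs => ?_
    exact (Real.toNNReal_le_iff_le_coe.2 hs.2).trans ht
  have hmain := tendsto_sum_inner_increments t.coe_nonneg
    (Matrix.toEuclideanCLM (𝕜 := ℝ) (driftMatrix d a)) (U := fun s : ℝ => U s.toNNReal ω)
    (X := fun s : ℝ => Matrix.toEuclideanCLM (𝕜 := ℝ) (diffusionMatrix d ε σ) (B s.toNNReal ω))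
    hη hcont' fun s hs => by
      have := heq s.toNNReal ((Real.toNNReal_le_iff_le_coe.2 hs.2).trans ht)
      rw [Real.coe_toNNReal _ hs.1] at this
      simpa only [Real.toNNReal_zero] using this
  have hlim := hmain.const_add (inner ℝ (η 0) (U 0 ω))
  simp only [Real.toNNReal_zero, Real.toNNReal_coe, add_sub_cancel] at hlim
  refine hlim.congr fun n => ?_
  congr 1
  refine Finset.sum_congr rfl fun i _ => ?_
  have hτ : ∀ j : ℕ, ((j : ℝ) * t / (n + 1)).toNNReal = (j : ℝ≥0) * t / (n + 1) := fun j => by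
    rw [← Real.toNNReal_coe (r := (j : ℝ≥0) * t / (n + 1))]
    push_cast
    rfl
  rw [hτ, hτ, ContinuousLinearMap.adjoint_inner_left, map_sub]

/-- The discretised variables have explicit characteristic functions, by independence of `U 0` and
`B`. The left side converges by dominated convergence, as the integrands have modulus one, and the
variances are Riemann sums of `G'`. -/
theorem IsForwardProcess.charFun_map_eq [IsProbabilityMeasure P]
    (hU : IsForwardProcess P a ε σ v π T B U) {t : ℝ≥0}
    (ht : t ≤ T) {η : ℝ → Phase d} {G : ℝ → ℝ}
    (hη : ∀ s, HasDerivAt η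
      (-((Matrix.toEuclideanCLM (𝕜 := ℝ) (driftMatrix d a)).adjoint (η s))) s)
    (hG : ∀ s, HasDerivAt G
      (‖(Matrix.toEuclideanCLM (𝕜 := ℝ) (diffusionMatrix d ε σ)).adjoint (η s)‖ ^ 2) s) :
    charFun (P.map (U t)) (η t) =
      charFun (initialLaw π v) (η 0) * Complex.exp (-((G t - G 0) / 2 : ℝ)) := by
  have hηc : Continuous η := continuous_iff_continuousAt.2 fun s => (hη s).continuousAt
  set w : ℝ → Phase d := fun s =>
    (Matrix.toEuclideanCLM (𝕜 := ℝ) (diffusionMatrix d ε σ)).adjoint (η s) with hw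
  have hwc : Continuous w := by fun_prop
  set τ : ℕ → ℕ → ℝ≥0 := fun n i => (i : ℝ≥0) * t / (n + 1) with hτ_def
  have hτ_coe : ∀ n i : ℕ, (τ n i : ℝ) = (i : ℝ) * t / (n + 1) := fun n i => by
    simp [hτ_def]
  have hτ : ∀ n, Monotone (τ n) := fun n i j hij => by
    simp only [hτ_def]
    gcongr
  set S : ℕ → Ω → ℝ := fun n ω => ∑ i ∈ Finset.range (n + 1),
    inner ℝ (w ((i : ℝ) * t / (n + 1))) (B (τ n (i + 1)) ω - B (τ n i) ω) with hS_def
  have hBm := hU.brownian.aemeasurable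
  have hU0m := hU.aemeasurable 0 zero_le
  have hSm : ∀ n, AEMeasurable (S n) P := fun n => by
    simp only [hS_def]
    fun_prop
  have hXm : AEMeasurable (fun ω => inner ℝ (η 0) (U 0 ω)) P := by fun_prop
  have hchar : ∀ n, ∫ ω, Complex.exp ((inner ℝ (η 0) (U 0 ω) + S n ω : ℝ) * Complex.I) ∂P =
      charFun (initialLaw π v) (η 0) * Complex.exp (-((∑ i ∈ Finset.range (n + 1),
        ‖w ((i : ℝ) * t / (n + 1))‖ ^ 2 *
          (((i + 1 : ℕ) : ℝ) * t / (n + 1) - (i : ℝ) * t / (n + 1))) / 2 : ℝ)) := fun n => by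
    have hind : IndepFun (fun ω => inner ℝ (η 0) (U 0 ω)) (S n) P :=
      hU.init_indep.comp (φ := fun u => inner ℝ (η 0) u)
        (ψ := fun x : ℝ≥0 → Phase d => ∑ i ∈ Finset.range (n + 1),
          inner ℝ (w ((i : ℝ) * t / (n + 1))) (x (τ n (i + 1)) - x (τ n i)))
        (by fun_prop) (by fun_prop)
    have h1 := congrFun (hind.charFun_map_fun_add_eq_mul hXm (hSm n)) 1
    rw [Pi.mul_apply, hU.brownian.charFun_map_sum_increments (hτ n)
      (fun i => w ((i : ℝ) * t / (n + 1))) (n + 1)] at h1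
    have h2 : charFun (P.map fun ω => inner ℝ (η 0) (U 0 ω)) 1 =
        charFun (initialLaw π v) (η 0) := by
      rw [← hU.init_law, charFun_apply_real, charFun_apply, integral_map hXm (by fun_prop),
        integral_map hU0m (by fun_prop)]
      simp [real_inner_comm]
    rw [h2, charFun_apply_real, integral_map (by fun_prop) (by fun_prop)] at h1
    simpa [hτ_coe] using h1
  have hleft : Tendsto (fun n => ∫ ω, Complex.exp ((inner ℝ (η 0) (U 0 ω) + S n ω : ℝ) * Complex.I) ∂P)
      atTop (𝓝 (∫ ω, Complex.exp ((inner ℝ (η t) (U t ω) : ℝ) * Complex.I) ∂P)) := by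
    refine tendsto_integral_of_dominated_convergence (fun _ => 1) (fun n => ?_)
      (integrable_const _) (fun n => ae_of_all _ fun ω => ?_) ?_
    · have : AEMeasurable (fun ω => Complex.exp ((inner ℝ (η 0) (U 0 ω) + S n ω : ℝ) * Complex.I))
        P := by fun_prop
      exact this.aestronglyMeasurable
    · rw [Complex.norm_exp_ofReal_mul_I]
    · filter_upwards [hU.ae_tendsto ht hη] with ω hω
      exact (Complex.continuous_exp.tendsto _).comp
        (((Complex.continuous_ofReal.tendsto _).comp hω).mul_const _)
  have hright := tendsto_riemann_sum t.coe_nonneg (by fun_prop : Continuous fun s => ‖w s‖ ^ 2) hG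
  have hright' : Tendsto (fun n : ℕ => charFun (initialLaw π v) (η 0) *
      Complex.exp (-((∑ i ∈ Finset.range (n + 1), ‖w ((i : ℝ) * t / (n + 1))‖ ^ 2 *
          (((i + 1 : ℕ) : ℝ) * t / (n + 1) - (i : ℝ) * t / (n + 1))) / 2 : ℝ))) atTop
      (𝓝 (charFun (initialLaw π v) (η 0) * Complex.exp (-((G t - G 0) / 2 : ℝ)))) := by
    have hcont : Continuous fun x : ℝ => charFun (initialLaw π v) (η 0) *
      Complex.exp (-(x / 2 : ℝ)) := by fun_prop
    exact (hcont.tendsto _).comp hright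
  simp_rw [hchar] at hleft
  rw [← tendsto_nhds_unique hleft hright', charFun_apply,
    integral_map (hU.aemeasurable t ht) (by fun_prop)]
  simp [real_inner_comm]

end Forward

/-! ### The flow and the covariance -/

section Flow

variable {d : ℕ} {a ε σ : ℝ}

theorem adjoint_toEuclideanCLM {n : Type*} [Fintype n] [DecidableEq n] (M : Matrix n n ℝ) :
    (Matrix.toEuclideanCLM (𝕜 := ℝ) M).adjoint = Matrix.toEuclideanCLM (𝕜 := ℝ) Mᵀ := by
  rw [← ContinuousLinearMap.star_eq_adjoint, ← map_star, Matrix.star_eq_conjTranspose,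
    Matrix.conjTranspose_eq_transpose_of_trivial]

theorem flow_zero : flow d a 0 = 1 := by
  rw [flow, zero_smul, NormedSpace.exp_zero]

theorem flow_mul_flow_neg (t : ℝ) : flow d a t * flow d a (-t) = 1 := by
  rw [flow, flow, neg_smul, Matrix.exp_neg]
  exact Matrix.mul_nonsing_inv _ ((Matrix.isUnit_iff_isUnit_det _).1 (Matrix.isUnit_exp _))

theorem flow_neg_mul_flow (t : ℝ) : flow d a (-t) * flow d a t = 1 := by
  simpa using flow_mul_flow_neg (d := d) (a := a) (-t)

open scoped Matrix.Norms.L2Operator in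
theorem hasDerivAt_flow_transpose (s : ℝ) (ξ : Phase d) :
    HasDerivAt (fun s => Matrix.toEuclideanCLM (𝕜 := ℝ) (flow d a s)ᵀ ξ)
      (Matrix.toEuclideanCLM (𝕜 := ℝ) (driftMatrix d a)ᵀ
        (Matrix.toEuclideanCLM (𝕜 := ℝ) (flow d a s)ᵀ ξ)) s := by
  let Λ : Matrix (Fin 2 × Fin d) (Fin 2 × Fin d) ℝ →L[ℝ] Phase d :=
    LinearMap.toContinuousLinearMap
      { toFun := fun M => Matrix.toEuclideanCLM (𝕜 := ℝ) Mᵀ ξ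
        map_add' := fun M N => by rw [Matrix.transpose_add, map_add, add_apply]
        map_smul' := fun c M => by rw [Matrix.transpose_smul, map_smul]; rfl }
  have h1 : HasDerivAt (fun s : ℝ => flow d a s) (flow d a s * driftMatrix d a) s :=
    hasDerivAt_exp_smul_const (driftMatrix d a) s
  have h2 := Λ.hasFDerivAt.comp_hasDerivAt s h1
  refine h2.congr_deriv ?_
  change Matrix.toEuclideanCLM (𝕜 := ℝ) (flow d a s * driftMatrix d a)ᵀ ξ = _
  rw [Matrix.transpose_mul, map_mul]
  rfl

/-- The Lyapunov equation for the stationary covariance. -/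
theorem lyapunov (ha : 0 < a) :
    driftMatrix d a * covInfty d a ε σ + covInfty d a ε σ * (driftMatrix d a)ᵀ =
      -(diffusionMatrix d ε σ * (diffusionMatrix d ε σ)ᵀ) := by
  rw [driftMatrix, covInfty, diffusionMatrix, ← Matrix.kroneckerMap_transpose,
    ← Matrix.kroneckerMap_transpose, Matrix.transpose_one,
    ← Matrix.mul_kronecker_mul, ← Matrix.mul_kronecker_mul, ← Matrix.mul_kronecker_mul, mul_one,
    ← Matrix.add_kronecker,
    ← neg_one_smul ℝ ((!![ε, 0; 0, σ] * _) ⊗ₖ (1 : Matrix (Fin d) (Fin d) ℝ)),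
    ← Matrix.smul_kronecker]
  congr 1
  ext i j
  simp only [Matrix.add_apply, Matrix.smul_apply, Matrix.mul_apply, Fin.sum_univ_two,
    Matrix.transpose_apply]
  fin_cases i <;> fin_cases j <;> simp <;> field_simp <;> ring

theorem covInfty_transpose : (covInfty d a ε σ)ᵀ = covInfty d a ε σ := by
  rw [covInfty, ← Matrix.kroneckerMap_transpose, Matrix.transpose_one]
  congr 1
  ext i j
  fin_cases i <;> fin_cases j <;> simp

theorem inner_toEuclideanCLM_transpose {n : Type*} [Fintype n] [DecidableEq n] (M : Matrix n n ℝ)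
    (x y : EuclideanSpace ℝ n) :
    inner ℝ (Matrix.toEuclideanCLM (𝕜 := ℝ) Mᵀ x) y =
      inner ℝ x (Matrix.toEuclideanCLM (𝕜 := ℝ) M y) := by
  rw [← adjoint_toEuclideanCLM, ContinuousLinearMap.adjoint_inner_left]

theorem toEuclideanCLM_mul_apply {n : Type*} [Fintype n] [DecidableEq n] (M N : Matrix n n ℝ)
    (x : EuclideanSpace ℝ n) : Matrix.toEuclideanCLM (𝕜 := ℝ) (M * N) x =
      Matrix.toEuclideanCLM (𝕜 := ℝ) M (Matrix.toEuclideanCLM (𝕜 := ℝ) N x) := by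
  rw [map_mul]
  rfl

/-- The derivative is `-⟨η, (A Σ_∞ + Σ_∞ Aᵀ) η⟩`, which the Lyapunov equation turns into the rate of
variance. This gives an explicit antiderivative `G` for `IsForwardProcess.charFun_map_eq`. -/
theorem hasDerivAt_inner_covInfty (ha : 0 < a) {η : ℝ → Phase d}
    (hη : ∀ s, HasDerivAt η
      (-((Matrix.toEuclideanCLM (𝕜 := ℝ) (driftMatrix d a)).adjoint (η s))) s) (s : ℝ) :
    HasDerivAt (fun s => inner ℝ (η s) (Matrix.toEuclideanCLM (𝕜 := ℝ) (covInfty d a ε σ) (η s)))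
      (‖(Matrix.toEuclideanCLM (𝕜 := ℝ) (diffusionMatrix d ε σ)).adjoint (η s)‖ ^ 2) s := by
  have h1 := (Matrix.toEuclideanCLM (𝕜 := ℝ) (covInfty d a ε σ)).hasFDerivAt.comp_hasDerivAt s (hη s)
  refine ((hη s).inner ℝ h1).congr_deriv ?_
  have hL := congrArg (fun M => inner ℝ (η s) (Matrix.toEuclideanCLM (𝕜 := ℝ) M (η s)))
    (lyapunov (d := d) (ε := ε) (σ := σ) ha)
  simp only [map_add, map_neg, add_apply, neg_apply, inner_add_right, inner_neg_right,
    toEuclideanCLM_mul_apply] at hL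
  rw [← inner_toEuclideanCLM_transpose, ← inner_toEuclideanCLM_transpose (diffusionMatrix d ε σ),
    real_inner_self_eq_norm_sq] at hL
  rw [adjoint_toEuclideanCLM, adjoint_toEuclideanCLM]
  simp only [Function.comp_apply, map_neg, inner_neg_right, inner_neg_left]
  linarith

/-- The adjoint solution with prescribed terminal value: it equals `ξ` at `s = t` and `(e^{tA})ᵀ ξ`
at `s = 0`. -/
theorem hasDerivAt_adjoint_flow (t : ℝ) (ξ : Phase d) (s : ℝ) :
    HasDerivAt (fun s => Matrix.toEuclideanCLM (𝕜 := ℝ) (flow d a (t - s))ᵀ ξ)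
      (-((Matrix.toEuclideanCLM (𝕜 := ℝ) (driftMatrix d a)).adjoint
        (Matrix.toEuclideanCLM (𝕜 := ℝ) (flow d a (t - s))ᵀ ξ))) s := by
  rw [adjoint_toEuclideanCLM]
  exact (hasDerivAt_flow_transpose (a := a) (t - s) ξ).comp_const_sub t s

/-- The exponents `t - t` and `t - 0` are kept so that the right side is literally `G t - G 0` for
the adjoint solution ending at `ξ`. -/
theorem inner_covZero (t : ℝ) (ξ : Phase d) :
    inner ℝ ξ (Matrix.toEuclideanCLM (𝕜 := ℝ) (covZero d a ε σ t) ξ) =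
      inner ℝ (Matrix.toEuclideanCLM (𝕜 := ℝ) (flow d a (t - t))ᵀ ξ)
        (Matrix.toEuclideanCLM (𝕜 := ℝ) (covInfty d a ε σ)
          (Matrix.toEuclideanCLM (𝕜 := ℝ) (flow d a (t - t))ᵀ ξ)) -
      inner ℝ (Matrix.toEuclideanCLM (𝕜 := ℝ) (flow d a (t - 0))ᵀ ξ)
        (Matrix.toEuclideanCLM (𝕜 := ℝ) (covInfty d a ε σ)
          (Matrix.toEuclideanCLM (𝕜 := ℝ) (flow d a (t - 0))ᵀ ξ)) := by
  rw [sub_self, sub_zero, flow_zero, Matrix.transpose_one, map_one, covZero, map_sub,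
    _root_.sub_apply, inner_sub_right, toEuclideanCLM_mul_apply, toEuclideanCLM_mul_apply,
    inner_toEuclideanCLM_transpose (flow d a t)]
  rfl

theorem covZero_isHermitian (t : ℝ) : (covZero d a ε σ t).IsHermitian := by
  rw [Matrix.IsHermitian, Matrix.conjTranspose_eq_transpose_of_trivial, covZero,
    Matrix.transpose_sub, Matrix.transpose_mul, Matrix.transpose_mul, Matrix.transpose_transpose,
    covInfty_transpose, Matrix.mul_assoc]

/-- The form is the increment over `[0, t]` of a function whose derivative is a squared norm. -/
theorem inner_covZero_nonneg (ha : 0 < a) {t : ℝ} (ht : 0 ≤ t) (ξ : Phase d) :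
    0 ≤ inner ℝ ξ (Matrix.toEuclideanCLM (𝕜 := ℝ) (covZero d a ε σ t) ξ) := by
  rw [inner_covZero, sub_nonneg]
  have hG := hasDerivAt_inner_covInfty (ε := ε) (σ := σ) ha
    (hasDerivAt_adjoint_flow (d := d) (a := a) t ξ)
  have hmono := monotone_of_deriv_nonneg (fun s => (hG s).differentiableAt)
    fun s => by
      rw [(hG s).deriv]
      positivity
  exact hmono ht

theorem IsForwardProcess.charFun_map_eq_covZero {Ω : Type*} [MeasurableSpace Ω] {P : Measure Ω}
    [IsProbabilityMeasure P] {v : ℝ} {π : Measure (Pos d)} {T : ℝ≥0} {B U : ℝ≥0 → Ω → Phase d}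
    (ha : 0 < a) (hU : IsForwardProcess P a ε σ v π T B U) {t : ℝ≥0} (ht : t ≤ T) (ξ : Phase d) :
    charFun (P.map (U t)) ξ =
      charFun (initialLaw π v) (Matrix.toEuclideanCLM (𝕜 := ℝ) (flow d a t)ᵀ ξ) *
        Complex.exp (-(inner ℝ ξ (Matrix.toEuclideanCLM (𝕜 := ℝ) (covZero d a ε σ t) ξ) / 2 :
          ℝ)) := by
  have hη := hasDerivAt_adjoint_flow (d := d) (a := a) t ξ
  have h := hU.charFun_map_eq ht hη (hasDerivAt_inner_covInfty ha hη)
  rw [← inner_covZero, sub_self, sub_zero, flow_zero, Matrix.transpose_one, map_one] at h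
  exact h

end Flow

/-! ### Extreme eigenvalues -/

section Spectrum

variable {n : Type*} [Fintype n] [DecidableEq n]

theorem inner_toEuclideanCLM_eq_sum {M : Matrix n n ℝ} (hM : M.IsHermitian)
    (x : EuclideanSpace ℝ n) : inner ℝ x (Matrix.toEuclideanCLM (𝕜 := ℝ) M x) =
      ∑ k, hM.eigenvalues k * inner ℝ (hM.eigenvectorBasis k) x ^ 2 := by
  rw [← hM.eigenvectorBasis.sum_inner_mul_inner]
  refine Finset.sum_congr rfl fun k _ => ?_
  have hMT : Mᵀ = M := by
    rw [← Matrix.conjTranspose_eq_transpose_of_trivial]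
    exact hM
  have hev : Matrix.toEuclideanCLM (𝕜 := ℝ) M (hM.eigenvectorBasis k) =
      hM.eigenvalues k • hM.eigenvectorBasis k := by
    ext i
    exact congrFun (hM.mulVec_eigenvectorBasis k) i
  rw [← inner_toEuclideanCLM_transpose, hMT, hev, inner_smul_left, real_inner_comm x]
  simp only [conj_trivial]
  ring

theorem eigenvalues_le_lambdaMax {M : Matrix n n ℝ} (hM : M.IsHermitian) (k : n) :
    hM.eigenvalues k ≤ lambdaMax M := by
  rw [lambdaMax, hM.spectrum_real_eq_range_eigenvalues]
  exact le_csSup (finite_range _).bddAbove ⟨k, rfl⟩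

theorem eigenvalues_nonneg_of_inner_nonneg {M : Matrix n n ℝ} (hM : M.IsHermitian)
    (h : ∀ x, 0 ≤ inner ℝ x (Matrix.toEuclideanCLM (𝕜 := ℝ) M x)) (k : n) :
    0 ≤ hM.eigenvalues k := by
  have := h (hM.eigenvectorBasis k)
  rw [inner_toEuclideanCLM_eq_sum hM, Finset.sum_eq_single k] at this
  · simpa using this
  · intro j _ hj
    rw [hM.eigenvectorBasis.orthonormal.2 hj]
    simp
  · simp

/-- The Rayleigh bound for `Nᵀ * N`, positive definite since `N` is invertible. A nonempty index
makes the infimum an attained eigenvalue; the infimum of an empty spectrum would default to `0`. -/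
theorem sigmaMin_sq_pos_and_le [Nonempty n] {N : Matrix n n ℝ} (hN : IsUnit N) :
    0 < sigmaMin N ^ 2 ∧
      ∀ x, sigmaMin N ^ 2 * ‖x‖ ^ 2 ≤ ‖Matrix.toEuclideanCLM (𝕜 := ℝ) N x‖ ^ 2 := by
  have hpos : (Nᵀ * N).PosDef := by
    rw [← Matrix.conjTranspose_eq_transpose_of_trivial]
    exact Matrix.PosDef.conjTranspose_mul_self N (Matrix.mulVec_injective_of_isUnit hN)
  have hH := hpos.isHermitian
  have hspec := hH.spectrum_real_eq_range_eigenvalues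
  have hInf : sInf (spectrum ℝ (Nᵀ * N)) ∈ range hH.eigenvalues := by
    rw [hspec]
    exact (range_nonempty _).csInf_mem (finite_range _)
  have hInf_pos : 0 < sInf (spectrum ℝ (Nᵀ * N)) := by
    obtain ⟨k, hk⟩ := hInf
    rw [← hk]
    exact hpos.eigenvalues_pos k
  have hsq : sigmaMin N ^ 2 = sInf (spectrum ℝ (Nᵀ * N)) := Real.sq_sqrt hInf_pos.le
  refine ⟨hsq ▸ hInf_pos, fun x => ?_⟩
  have h1 : ‖Matrix.toEuclideanCLM (𝕜 := ℝ) N x‖ ^ 2 =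
      ∑ k, hH.eigenvalues k * inner ℝ (hH.eigenvectorBasis k) x ^ 2 := by
    rw [← inner_toEuclideanCLM_eq_sum hH, toEuclideanCLM_mul_apply, real_inner_comm,
      inner_toEuclideanCLM_transpose, real_inner_self_eq_norm_sq]
  rw [h1, hsq, ← hH.eigenvectorBasis.sum_sq_inner_right x, Finset.mul_sum]
  refine Finset.sum_le_sum fun k _ => ?_
  gcongr
  rw [hspec]
  exact csInf_le (finite_range _).bddBelow ⟨k, rfl⟩

end Spectrum

/-- The flow `e^{tA}` as a linear automorphism of phase space. -/
noncomputable def flowEquiv (d : ℕ) (a t : ℝ) : Phase d ≃L[ℝ] Phase d :=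
  ContinuousLinearEquiv.equivOfInverse (Matrix.toEuclideanCLM (𝕜 := ℝ) (flow d a t))
    (Matrix.toEuclideanCLM (𝕜 := ℝ) (flow d a (-t)))
    (fun x => by rw [← toEuclideanCLM_mul_apply, flow_neg_mul_flow, map_one]; rfl)
    (fun x => by rw [← toEuclideanCLM_mul_apply, flow_mul_flow_neg, map_one]; rfl)

theorem charFun_map_flowEquiv {d : ℕ} {a t : ℝ} (μ : Measure (Phase d)) (ξ : Phase d) :
    charFun (μ.map (flowEquiv d a t)) ξ =
      charFun μ (Matrix.toEuclideanCLM (𝕜 := ℝ) (flow d a t)ᵀ ξ) := by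
  rw [charFun_apply, charFun_apply, integral_map (by fun_prop) (by fun_prop)]
  refine integral_congr_ae (ae_of_all _ fun x => ?_)
  simp only
  rw [real_inner_comm _ x, inner_toEuclideanCLM_transpose, real_inner_comm]
  rfl

end KineticOU

/-! ### Log-concavity of the law of the forward process -/

theorem mainTheorem4 {d : ℕ} (hd : 0 < d) {a ε σ v : ℝ} (ha : 0 < a) (hε : 0 ≤ ε) (hσ : 0 < σ)
    (hv : 0 < v) {π : Measure (KineticOU.Pos d)} {V : KineticOU.Pos d → ℝ} {α₀ L₀ : ℝ}
    (hπ : KineticOU.StronglyLogConcaveSmooth π V α₀ L₀)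
    {Ω : Type*} [MeasurableSpace Ω] {P : Measure Ω} [IsProbabilityMeasure P] {T : ℝ≥0}
    {B U : ℝ≥0 → Ω → KineticOU.Phase d}
    (hU : KineticOU.IsForwardProcess P a ε σ v π T B U) (t : ℝ≥0) (ht : t ≤ T) :
    0 < KineticOU.alphaT d a ε σ v α₀ t ∧
    ∃ p : KineticOU.Phase d → ℝ,
      (∀ u, 0 < p u) ∧
      P.map (U t) = volume.withDensity (fun u => ENNReal.ofReal (p u)) ∧
      KineticOU.TwiceDifferentiable p ∧
      KineticOU.HessianLE (fun u => Real.log (p u)) (-KineticOU.alphaT d a ε σ v α₀ t) := by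
  open KineticOU in
  have : Nonempty (Fin 2 × Fin d) := ⟨(0, ⟨0, hd⟩)⟩
  have hunit : IsUnit (flow d a (-t)) :=
    ⟨⟨flow d a (-t), flow d a t, flow_neg_mul_flow _, flow_mul_flow_neg _⟩, rfl⟩
  obtain ⟨hs_pos, hs_le⟩ := sigmaMin_sq_pos_and_le hunit
  have hm_pos : 0 < min α₀ (v ^ 2)⁻¹ := lt_min hπ.alpha_pos (by positivity)
  have hM_nonneg : 0 ≤ max L₀ (v ^ 2)⁻¹ := hπ.L_pos.le.trans (le_max_left _ _)
  have hH := covZero_isHermitian (d := d) (a := a) (ε := ε) (σ := σ) t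
  have hl := eigenvalues_nonneg_of_inner_nonneg hH (inner_covZero_nonneg ha t.coe_nonneg)
  have hL := eigenvalues_le_lambdaMax hH
  have hmax : 0 ≤ lambdaMax (covZero d a ε σ t) :=
    (hl (0, ⟨0, hd⟩)).trans (hL _)
  have hα : 0 < min α₀ (v ^ 2)⁻¹ * sigmaMin (flow d a (-t)) ^ 2 := mul_pos hm_pos hs_pos
  refine ⟨by rw [alphaT]; positivity, ?_⟩
  obtain ⟨W, hW, hWge, hWle, hlaw⟩ := exists_initialLaw_eq_withDensity hv hπ
  set L := flowEquiv d a t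
  set c := -Real.log |(LinearMap.det (L : Phase d →ₗ[ℝ] Phase d))⁻¹|
  have hmap := withDensity_exp_neg_map hW.1.continuous.measurable L
  set W' : Phase d → ℝ := fun x => W (L.symm x) + c with hW'_def
  have hWL : TwiceDifferentiable fun x => W (L.symm x) :=
    hW.comp_clm (L.symm : Phase d →L[ℝ] Phase d)
  have hW' : TwiceDifferentiable W' := hWL.add_const c
  have hhess : ∀ x h, hessianForm W' x h = hessianForm W (L.symm x) (L.symm h) := fun x h => by
    rw [hW'_def, hessianForm_add_const]
    exact hessianForm_comp_clm hW (L.symm : Phase d →L[ℝ] Phase d) x h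
  have hge : HessianGE (min α₀ (v ^ 2)⁻¹ * sigmaMin (flow d a (-t)) ^ 2) W' := fun x h => by
    rw [hhess]
    refine le_trans ?_ (hWge (L.symm x) (L.symm h))
    rw [mul_assoc]
    -- `L.symm` is `e^{-tA}`, whose smallest singular value bounds `‖L.symm h‖` from below.
    exact mul_le_mul_of_nonneg_left (hs_le h) hm_pos.le
  have hle : HessianLE W' (max L₀ (v ^ 2)⁻¹ * ‖(L.symm : Phase d →L[ℝ] Phase d)‖ ^ 2) := fun x h => by
    rw [hhess]
    refine (hWle (L.symm x) (L.symm h)).trans ?_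
    rw [mul_assoc, ← mul_pow]
    gcongr
    exact (L.symm : Phase d →L[ℝ] Phase d).le_opNorm h
  have hp := boundedSmooth_exp_neg hW' hα hge (by positivity) hle
  have hmid := hge.midpointLogConcave_exp hW'
  have hprob₀ : IsProbabilityMeasure (initialLaw π v) := by
    rw [← hU.init_law]
    exact Measure.isProbabilityMeasure_map (hU.aemeasurable 0 zero_le)
  have hfin : IsFiniteMeasure (volume.withDensity fun x => ENNReal.ofReal (Real.exp (-W' x))) := by
    rw [← hmap, ← hlaw]
    infer_instance
  have hprob : IsProbabilityMeasure (P.map (U t)) :=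
    Measure.isProbabilityMeasure_map (hU.aemeasurable t ht)
  -- The variances are the eigenvalues of `Σ_{0,t}`, bounded by `lambdaMax`; the resulting constant
  -- `(1 / α + L)⁻¹` is `alphaT` by definition.
  obtain ⟨q, hq, hqmid, hqlaw⟩ := exists_density_of_charFun_eq hH.eigenvectorBasis hl hL hα hp hmid
    (μ := P.map (U t)) fun ξ => by
      rw [hU.charFun_map_eq_covZero ha ht, ← hmap, ← hlaw, charFun_map_flowEquiv,
        inner_toEuclideanCLM_eq_sum hH]
  exact ⟨q, hq.pos, hqlaw, hq.twiceDiff, hqmid.hessianLE_log hq.twiceDiff hq.pos⟩
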